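/- Let $\mathbb G$ be a homogeneous group, i.e. $\mathbb R^N$ ($N\ge 1$) with a Lie group law for which the dilations $D_\lambda(x)=(\lambda^{v_1}x_1,\dots,\lambda^{v_N}x_N)$, $\lambda>0$ (with fixed $v_1,\dots,v_N>0$), are automorphisms. Let $Q=v_1+\dots+v_N$ be its homogeneous dimension and $dx$ Lebesgue (= Haar) measure. Let $|\cdot|:\mathbb G\to[0,\infty)$ be a quasi-norm: continuous, $|x^{-1}|=|x|$, $|D_\lambda x|=\lambda|x|$ for $\lambda>0$, and $|x|=0$ iff $x=0$. Put $\mathbb B(0,r)=\{y:|y|<r\}$ and $\mathfrak S=\{x:|x|=1\}$, and let $|\mathfrak S|=\sigma(\mathfrak S)$, where $\sigma$ is the unique Radon measure on $\mathfrak S$ with $\int_{\mathbb G}f(x)\,dx=\int_0^\infty\int_{\mathfrak S}f(D_ry)\,r^{Q-1}\,d\sigma(y)\,dr$ for all $f\in L^1(\mathbb G)$. Let $1<p\le q<\infty$, $p'=p/(p-1)$ and $\alpha,\beta\in\mathbb R$. There is a constant $C<\infty$ such that $$\left(\int_{\mathbb G}\left|\int_{\mathbb G\setminus\mathbb B(0,|x|)}u(y)\,dy\right|^q|x|^\beta\,dx\right)^{1/q}\le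 C\left(\int_{\mathbb G}|u(x)|^p|x|^\alpha\,dx\right)^{1/p}$$ for all measurable $u$ on $\mathbb G$ (where, if the right-hand side is finite, the inner integral is required to converge absolutely for every $x\ne0$) if and only if $$\alpha>Q(p-1)\quad\text{and}\quad q(\alpha+Q)-p(\beta+Q)=pqQ.$$ Moreover, under these conditions the least such constant $C$ is $$C(p,q,Q,\alpha)=|\mathfrak S|^{1+\frac1q-\frac1p}\left(\frac{p-1}{\alpha-Q(p-1)}\right)^{\frac1{p'}+\frac1q}\left(\frac{p'}{q}\right)^{\frac1q}\left(\frac{\frac{q-p}{p}\,\Gamma\!\left(\frac{pq}{q-p}\right)}{\Gamma\!\left(\frac{p}{q-p}\right)\Gamma\!\left(\frac{p(q-1)}{q-p}\right)}\right)^{\frac1p-\frac1q}$$ if $p<q$, and if $p=q$ it is $$C(p,p,Q,\alpha)=\lim_{s\to q^-}C(s,q,Q,\alpha)=\frac{p\,|\mathfrak S|}{\alpha-Q(p-1)}.$$ -/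

import Mathlib

open MeasureTheory Filter Topology

noncomputable section

/-- The anisotropic dilation `D_t (x) = (t ^ v₁ x₁, …, t ^ v_N x_N)` of `ℝ^N` with weights `v`. -/
def dilation {N : ℕ} (v : Fin N → ℝ) (t : ℝ) (x : Fin N → ℝ) : Fin N → ℝ :=
  fun i => t ^ v i * x i

/-- A homogeneous (Lie) group: a Lie group structure on the manifold `ℝ^N`, together with positive
weights, such that the dilations `D_t`, `t > 0`, are automorphisms of the group.
(The unit of the group is then necessarily the origin, and Lebesgue measure is a Haar measure.) -/
structure HomogeneousGroup (N : ℕ) where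
  /-- the group law of `G` on the set `ℝ^N` -/
  group : Group (Fin N → ℝ)
  contDiff_mul : ContDiff ℝ (⊤ : ℕ∞)
    (fun z : (Fin N → ℝ) × (Fin N → ℝ) => group.mul z.1 z.2)
  contDiff_inv : ContDiff ℝ (⊤ : ℕ∞) (fun x : Fin N → ℝ => group.inv x)
  /-- the weights `v₁, …, v_N` of the dilations -/
  weight : Fin N → ℝ
  weight_pos : ∀ i, 0 < weight i
  dilation_mul : ∀ t : ℝ, 0 < t → ∀ x y : Fin N → ℝ,
    dilation weight t (group.mul x y) = group.mul (dilation weight t x) (dilation weight t y)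

namespace HomogeneousGroup

variable {N : ℕ}

/-- The dilations of a homogeneous group. -/
def dil (G : HomogeneousGroup N) (t : ℝ) (x : Fin N → ℝ) : Fin N → ℝ :=
  dilation G.weight t x

/-- The homogeneous dimension `Q = v₁ + ⋯ + v_N`. -/
def homDim (G : HomogeneousGroup N) : ℝ := ∑ i, G.weight i

/-- A quasi-norm on a homogeneous group: a continuous, nonnegative, symmetric function, homogeneous
of degree one for the dilations, vanishing exactly at the origin. -/
structure QuasiNorm (G : HomogeneousGroup N) where
  toFun : (Fin N → ℝ) → ℝ
  continuous_toFun : Continuous toFun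
  nonneg : ∀ x, 0 ≤ toFun x
  map_inv : ∀ x, toFun (G.group.inv x) = toFun x
  map_dil : ∀ t : ℝ, 0 < t → ∀ x, toFun (G.dil t x) = t * toFun x
  eq_zero_iff : ∀ x, toFun x = 0 ↔ x = 0

namespace QuasiNorm

variable {G : HomogeneousGroup N}

/-- The quasi-ball `B(0, r) = {y : |y| < r}` about the origin. -/
def ball (ν : G.QuasiNorm) (r : ℝ) : Set (Fin N → ℝ) := {y | ν.toFun y < r}

/-- The unit sphere `{x : |x| = 1}` of the quasi-norm. -/
def unitSphere (ν : G.QuasiNorm) : Set (Fin N → ℝ) := {x | ν.toFun x = 1}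

/-- The surface measure `σ` of the unit sphere, carried by `unitSphere` and seen as a measure on
`ℝ^N`. It is built as a cone measure, `σ(E) = Q · |{x : 0 < |x| < 1, x / |x| ∈ E}|`, where `x / |x|`
stands for `D_{1/|x|} x`. This is the unique Radon measure on the unit sphere for which the polar
decomposition `∫ f(x) dx = ∫_0^∞ ∫ f(D_r y) r^(Q-1) dσ(y) dr` holds: for `f` the indicator function
of `{x : 0 < |x| < 1, x / |x| ∈ E}` that identity reads `|{…}| = σ(E) / Q`. -/
def sphereMeasure (ν : G.QuasiNorm) : Measure (Fin N → ℝ) :=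
  ENNReal.ofReal G.homDim •
    (volume.restrict (ν.ball 1 \ {0})).map (fun x => G.dil (ν.toFun x)⁻¹ x)

/-- The measure `|𝔖| = σ(𝔖)` of the unit sphere. -/
def sphereArea (ν : G.QuasiNorm) : ℝ := ν.sphereMeasure.real ν.unitSphere

/-- The weighted conjugate Hardy inequality with constant `C`,
`(∫_G |∫_{G \ B(0,|x|)} u(y) dy|^q |x|^β dx)^(1/q) ≤ C (∫_G |u(x)|^p |x|^α dx)^(1/p)`,
for all measurable `𝕜`-valued functions `u` on `G`. When the right-hand side is infinite there is
nothing to show; when it is finite, the convergence of the inner integral for every `x ≠ 0` is part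
of the claim. The outer integrals take values in `[0, ∞]`. -/
def ConjugateHardyInequality (𝕜 : Type*) [RCLike 𝕜] (ν : G.QuasiNorm) (p q α β C : ℝ) : Prop :=
  ∀ u : (Fin N → ℝ) → 𝕜, Measurable u →
    (∫⁻ x, ‖u x‖ₑ ^ p * ENNReal.ofReal (ν.toFun x ^ α)) ≠ ⊤ →
    (∀ x : Fin N → ℝ, x ≠ 0 → IntegrableOn u (ν.ball (ν.toFun x))ᶜ) ∧
    (∫⁻ x, ‖∫ y in (ν.ball (ν.toFun x))ᶜ, u y‖ₑ ^ q * ENNReal.ofReal (ν.toFun x ^ β)) ^ (1 / q) ≤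
      ENNReal.ofReal C *
        (∫⁻ x, ‖u x‖ₑ ^ p * ENNReal.ofReal (ν.toFun x ^ α)) ^ (1 / p)

/-- For `1 < p < q`, the constant `C(p, q, Q, α)`, with `p' = p / (p - 1)`. -/
def sharpConstant (ν : G.QuasiNorm) (p q α : ℝ) : ℝ :=
  ν.sphereArea ^ (1 + 1 / q - 1 / p) *
    ((p - 1) / (α - G.homDim * (p - 1))) ^ (1 / p.conjExponent + 1 / q) *
    (p.conjExponent / q) ^ (1 / q) *
    (((q - p) / p * Real.Gamma (p * q / (q - p))) /
      (Real.Gamma (p / (q - p)) * Real.Gamma (p * (q - 1) / (q - p)))) ^ (1 / p - 1 / q)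

end QuasiNorm

end HomogeneousGroup

end

/-!
The group law plays no role beyond the dilations: since `D_r` is linear with determinant `r ^ Q`, the
quasi-ball of radius `r` has volume `V r ^ Q`, and this growth is all that the inequality uses of the
group (`PowerGrowth`, `HomogeneousGroup.QuasiNorm.powerGrowth`). It determines the distribution of
the gauge `ρ = |x|`, so integrals of functions of `ρ` are integrals over the half-line against
`|𝔖| r ^ (Q - 1) dr`. The inequality concerns the tails `φ(r) = ∫_{ρ ≥ r} |u|` only, and it is
invariant under replacing `ρ` by a power of itself.

For `p < q` a power of `ρ` brings the extremal tail to the form `ψ(r) = (1 + r) ^ (-m)` with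
`m = p / (q - p)`, and the inequality (`PowerGrowth.bliss`, Bliss's inequality) is proved by mass
transport. Let `T` be the monotone map of the half-line that transports `φ ^ q r ^ (b - 1) dr` to a
multiple `k` of `ψ ^ q y ^ (b - 1) dy`. The Jacobian equation, raised to the power `1 / n` with
`n = q m`, and the inequality of arithmetic and geometric means give
`(1 + T) φ ^ q r ^ (b - 1) ≤ const * k ^ (1 / n) * φ ^ H * (r ^ a T) ^ (1 / p')'`, where `a = n - 1`
and `H = q / p' + 1`, and the prime outside the bracket is a derivative
(`bliss_pointwise`). Integrating, writing `φ ^ H = ∫_{ρ ≥ r} H φ ^ (H - 1) |u|`, exchanging the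
integrals and applying Hölder's inequality to `u` bounds the integral of the right-hand side by the
energy of `u` and the integral of `T φ ^ q r ^ (b - 1)`. The integrals that contain `T` are Beta
integrals after the change of variables `y = T r`, so only `k`, the ratio of the masses, remains, and
it is the quantity to be bounded. Hölder's inequality is applied to `u` itself, so no reduction to
radial functions is needed. Every step is an equality for `φ = ψ`, which shows that the constant is
attained (`PowerGrowth.blissConst_le`).

For `p = q` the same argument with `T r = r` gives Hardy's inequality (`PowerGrowth.hardy`); its
constant is optimal by the powers of `ρ` near the critical one (`PowerGrowth.hardyConst_le`). The
limit of the constants as `p` increases to `q` follows from `log Γ(x) = x log x - x + o(x)`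
(`tendsto_Gamma_factor`). The conditions on the exponents are necessary by testing with indicator
functions of annuli and with truncations of `ρ ^ (-Q)`.
-/

section

open Set
open scoped ENNReal

/-! ### Measures of power growth and the tail inequality -/

/-- The measure `μ` grows like the power `Q` along the gauge `ρ`: the sublevel set `{ρ < r}` has
measure `V r ^ Q`. A quasi-norm on a homogeneous group satisfies this with `Q` the homogeneous
dimension and `V` the volume of the unit ball; `Q * V` is then the area of the unit sphere. -/
structure PowerGrowth {X : Type*} [MeasurableSpace X] (μ : Measure X) (ρ : X → ℝ) (V Q : ℝ) :
    Prop where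
  measurable : Measurable ρ
  nonneg : ∀ x, 0 ≤ ρ x
  const_pos : 0 < V
  dim_pos : 0 < Q
  measure_lt : ∀ r, 0 < r → μ {x | ρ x < r} = ENNReal.ofReal (V * r ^ Q)

namespace PowerGrowth

variable {X : Type*} [MeasurableSpace X] {μ : Measure X} {ρ : X → ℝ} {V Q : ℝ}

theorem measure_lt' (h : PowerGrowth μ ρ V Q) {r : ℝ} (hr : 0 ≤ r) :
    μ {x | ρ x < r} = ENNReal.ofReal (V * r ^ Q) := by
  rcases hr.eq_or_lt with rfl | hr
  · have : {x | ρ x < 0} = ∅ := by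
      ext x; simpa using h.nonneg x
    rw [this, Real.zero_rpow h.dim_pos.ne']; simp
  · exact h.measure_lt r hr

theorem measure_Ico (h : PowerGrowth μ ρ V Q) {a b : ℝ} (ha : 0 ≤ a) (hab : a ≤ b) :
    μ {x | a ≤ ρ x ∧ ρ x < b} = ENNReal.ofReal (V * b ^ Q - V * a ^ Q) := by
  have h1 : {x | a ≤ ρ x ∧ ρ x < b} = {x | ρ x < b} \ {x | ρ x < a} := by
    ext x; simp [and_comm]
  have h2 : {x | ρ x < a} ⊆ {x | ρ x < b} := fun x hx => by
    simp only [mem_ofPred_eq] at hx ⊢; exact hx.trans_le hab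
  rw [h1, measure_sdiff h2
    (measurableSet_lt h.measurable measurable_const).nullMeasurableSet
    (by rw [h.measure_lt' ha]; exact ENNReal.ofReal_ne_top),
    h.measure_lt' ha, h.measure_lt' (ha.trans hab), ENNReal.ofReal_sub]
  have := h.const_pos
  positivity

theorem sigmaFinite (h : PowerGrowth μ ρ V Q) : SigmaFinite μ := by
  refine ⟨⟨⟨fun n : ℕ => {x | ρ x < n}, fun _ => trivial, fun n => ?_, ?_⟩⟩⟩
  · rw [h.measure_lt' n.cast_nonneg]; exact ENNReal.ofReal_lt_top
  · ext x
    simp only [mem_iUnion, mem_univ, iff_true]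
    exact exists_nat_gt (ρ x)

/-- Integration in polar coordinates, for functions of the gauge alone: the distribution of `ρ` has
the density `Q V r ^ (Q - 1)` on the half-line. -/
theorem map_eq (h : PowerGrowth μ ρ V Q) :
    μ.map ρ = (volume.restrict (Ioi 0)).withDensity
      (fun r => ENNReal.ofReal (Q * V * r ^ (Q - 1))) := by
  have hV := h.const_pos
  have hQ := h.dim_pos
  have key : ∀ a b : ℝ, a < b → μ.map ρ (Ico a b) =
      if 0 < b then ENNReal.ofReal (V * b ^ Q - V * (max a 0) ^ Q) else 0 := by
    intro a b hab
    rw [Measure.map_apply h.measurable measurableSet_Ico]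
    split_ifs with hb
    · rw [← h.measure_Ico (le_max_right a 0) (max_le hab.le hb.le)]
      congr 1
      ext x
      simp [h.nonneg x]
    · have : ρ ⁻¹' Ico a b = ∅ := by
        ext x
        simp only [mem_preimage, mem_Ico, mem_empty_iff_false, iff_false, not_and, not_lt]
        intro _
        exact (not_lt.1 hb).trans (h.nonneg x)
      rw [this, measure_empty]
  refine Measure.ext_of_Ico' _ _ (fun a b hab => ?_) (fun a b hab => ?_)
  · rw [key a b hab]; split_ifs <;> simp
  · rw [key a b hab, withDensity_apply _ measurableSet_Ico,
      Measure.restrict_restrict measurableSet_Ico]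
    split_ifs with hb
    · have hae : (Ico a b ∩ Ioi 0 : Set ℝ) =ᵐ[volume] Ioc (max a 0) b := by
        have : (Ico a b ∩ Ioi 0 : Set ℝ) =ᵐ[volume] (Ioc a b ∩ Ioi 0 : Set ℝ) :=
          (Ico_ae_eq_Ioc).inter (ae_eq_refl _)
        refine this.trans (Filter.EventuallyEq.of_eq ?_)
        ext x; simp
      have hm : max a 0 ≤ b := max_le hab.le hb.le
      rw [setLIntegral_congr hae, ← ofReal_integral_eq_lintegral_ofReal,
        ← intervalIntegral.integral_of_le hm, intervalIntegral.integral_const_mul,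
        integral_rpow (Or.inl (by linarith))]
      · congr 1
        have : Q - 1 + 1 = Q := by ring
        rw [this]; field_simp
      · rw [← IntegrableOn, ← intervalIntegrable_iff_integrableOn_Ioc_of_le hm]
        exact (intervalIntegral.intervalIntegrable_rpow' (by linarith)).const_mul _
      · filter_upwards [self_mem_ae_restrict measurableSet_Ioc] with x hx
        have : 0 < x := lt_of_le_of_lt (le_max_right a 0) hx.1
        positivity
    · have : Ico a b ∩ Ioi 0 = ∅ := by
        ext x; simp; intro _ h2; linarith
      rw [this]; simp

theorem lintegral_comp (h : PowerGrowth μ ρ V Q) {f : ℝ → ℝ≥0∞} (hf : Measurable f) :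
    ∫⁻ x, f (ρ x) ∂μ =
      ∫⁻ r in Ioi 0, ENNReal.ofReal (Q * V * r ^ (Q - 1)) * f r := by
  rw [← lintegral_map hf h.measurable, h.map_eq, lintegral_withDensity_eq_lintegral_mul _ _ hf]
  · rfl
  · fun_prop

theorem measure_eq_const (h : PowerGrowth μ ρ V Q) (r : ℝ) : μ {x | ρ x = r} = 0 := by
  have : {x | ρ x = r} = ρ ⁻¹' {r} := rfl
  rw [this, ← Measure.map_apply h.measurable (measurableSet_singleton r), h.map_eq]
  exact withDensity_absolutelyContinuous _ _ (by simp)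

theorem ae_pos (h : PowerGrowth μ ρ V Q) : ∀ᵐ x ∂μ, 0 < ρ x := by
  have := h.measure_eq_const 0
  filter_upwards [compl_mem_ae_iff.2 this] with x hx
  exact (h.nonneg x).lt_of_ne' hx

/-- Replacing the gauge `ρ` by `ρ ^ c` divides the exponent of growth by `c`. -/
theorem rpow (h : PowerGrowth μ ρ V Q) {c : ℝ} (hc : 0 < c) :
    PowerGrowth μ (fun x => ρ x ^ c) V (Q / c) where
  measurable := h.measurable.pow_const c
  nonneg x := Real.rpow_nonneg (h.nonneg x) c
  const_pos := h.const_pos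
  dim_pos := div_pos h.dim_pos hc
  measure_lt r hr := by
    have h1 : {x | ρ x ^ c < r} = {x | ρ x < r ^ c⁻¹} := by
      ext x
      simp only [mem_ofPred_eq]
      rw [Real.lt_rpow_inv_iff_of_pos (h.nonneg x) hr.le hc]
    rw [h1, h.measure_lt _ (Real.rpow_pos_of_pos hr _), ← Real.rpow_mul hr.le]
    congr 3
    field_simp

end PowerGrowth

/-- The mass of `u` outside the ball `{ρ < r}`. -/
noncomputable def tailIntegral {X : Type*} [MeasurableSpace X] (μ : Measure X) (ρ : X → ℝ)
    (u : X → ℝ≥0∞) (r : ℝ) : ℝ≥0∞ := ∫⁻ y in {y | r ≤ ρ y}, u y ∂μ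

/-- The weighted energy `∫ u ^ p ρ ^ α`; the right-hand side of the inequality is its `p`-th root. -/
noncomputable def weightedEnergy {X : Type*} [MeasurableSpace X] (μ : Measure X) (ρ : X → ℝ)
    (p α : ℝ) (u : X → ℝ≥0∞) : ℝ≥0∞ := ∫⁻ x, u x ^ p * ENNReal.ofReal (ρ x ^ α) ∂μ

/-- The weighted power integral of the tails of `u`, whose `q`-th root is the left-hand side of the
inequality. -/
noncomputable def tailEnergy {X : Type*} [MeasurableSpace X] (μ : Measure X) (ρ : X → ℝ)
    (q β : ℝ) (u : X → ℝ≥0∞) : ℝ≥0∞ :=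
  ∫⁻ x, tailIntegral μ ρ u (ρ x) ^ q * ENNReal.ofReal (ρ x ^ β) ∂μ

/-- The conjugate Hardy inequality with constant `K` for nonnegative functions, along a gauge `ρ` on
a measure space. Only functions of finite energy are tested, so that `K = 0` is not rescued by the
convention `0 * ∞ = 0`. -/
def TailInequality {X : Type*} [MeasurableSpace X] (μ : Measure X) (ρ : X → ℝ)
    (p q α β : ℝ) (K : ℝ≥0∞) : Prop :=
  ∀ u : X → ℝ≥0∞, Measurable u → weightedEnergy μ ρ p α u ≠ ⊤ →
    tailEnergy μ ρ q β u ^ (1 / q) ≤ K * weightedEnergy μ ρ p α u ^ (1 / p)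

section

variable {X : Type*} [MeasurableSpace X] {μ : Measure X} {ρ : X → ℝ} {V Q p q α β : ℝ}

theorem tailIntegral_antitone (μ : Measure X) (ρ : X → ℝ) (u : X → ℝ≥0∞) :
    Antitone (tailIntegral μ ρ u) := fun _ _ hab =>
  lintegral_mono_set fun _ hy => hab.trans hy

theorem measurable_tailIntegral (μ : Measure X) (ρ : X → ℝ) (u : X → ℝ≥0∞) :
    Measurable (tailIntegral μ ρ u) := (tailIntegral_antitone μ ρ u).measurable

theorem tailIntegral_ne_top {u : X → ℝ≥0∞} (hfin : ∫⁻ x, u x ∂μ ≠ ⊤) (r : ℝ) :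
    tailIntegral μ ρ u r ≠ ⊤ :=
  ne_top_of_le_ne_top hfin (setLIntegral_le_lintegral _ _)

theorem weightedEnergy_rpow (hρ : ∀ x, 0 ≤ ρ x) {c : ℝ} (hc : 0 < c) (u : X → ℝ≥0∞) :
    weightedEnergy μ (fun x => ρ x ^ c) p (α / c) u = weightedEnergy μ ρ p α u := by
  unfold weightedEnergy
  refine lintegral_congr fun x => ?_
  rw [← Real.rpow_mul (hρ x), mul_div_cancel₀ _ hc.ne']

theorem tailEnergy_rpow (hρ : ∀ x, 0 ≤ ρ x) {c : ℝ} (hc : 0 < c) (u : X → ℝ≥0∞) :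
    tailEnergy μ (fun x => ρ x ^ c) q (β / c) u = tailEnergy μ ρ q β u := by
  unfold tailEnergy tailIntegral
  refine lintegral_congr fun x => ?_
  rw [← Real.rpow_mul (hρ x), mul_div_cancel₀ _ hc.ne']
  congr 4
  ext y
  exact Real.rpow_le_rpow_iff (hρ x) (hρ y) hc

/-- The inequality does not see the parametrisation of the balls: passing from `ρ` to `ρ ^ c` only
divides the exponents of the weights by `c`. -/
theorem tailInequality_rpow (hρ : ∀ x, 0 ≤ ρ x) {c : ℝ} (hc : 0 < c) {K : ℝ≥0∞} :
    TailInequality μ (fun x => ρ x ^ c) p q (α / c) (β / c) K ↔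
      TailInequality μ ρ p q α β K := by
  unfold TailInequality
  simp only [weightedEnergy_rpow hρ hc, tailEnergy_rpow hρ hc]

end

/-! ### The chain rule for tails -/

section

variable (η : Measure ℝ) [IsFiniteMeasure η]

theorem antitone_measureReal_Ici : Antitone fun r => η.real (Ici r) := fun _ _ hab =>
  measureReal_mono (Ici_subset_Ici.2 hab)

theorem tendsto_measureReal_Ici_atTop : Tendsto (fun r => η.real (Ici r)) atTop (𝓝 0) := by
  have h := tendsto_measure_iInter_atTop (μ := η) (s := fun r : ℝ => Ici r)
    (fun _ => measurableSet_Ici.nullMeasurableSet) (fun _ _ hab => Ici_subset_Ici.2 hab)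
    ⟨0, measure_ne_top _ _⟩
  have h0 : ⋂ r : ℝ, Ici r = ∅ := by
    ext x; simp only [mem_iInter, mem_Ici, mem_empty_iff_false, iff_false, not_forall, not_le]
    exact exists_gt x
  rw [h0, measure_empty] at h
  have := (ENNReal.tendsto_toReal ENNReal.zero_ne_top).comp h
  simpa [Measure.real, Function.comp_def] using this

variable [NullSingletonClass η]

theorem continuous_measureReal_Ici : Continuous fun r => η.real (Ici r) := by
  have h1 : Continuous fun r => ∫ _x in (0:ℝ)..r, (1:ℝ) ∂η :=
    intervalIntegral.continuous_primitive (fun _ _ => intervalIntegrable_const) 0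
  have h2 : ∀ r, η.real (Ici r) = η.real (Ici 0) - ∫ _x in (0:ℝ)..r, (1:ℝ) ∂η := by
    intro r
    have e : ∀ a b : ℝ, a ≤ b → η.real (Ici a) = η.real (Ioc a b) + η.real (Ici b) := by
      intro a b hab
      rw [measureReal_congr (Ioi_ae_eq_Ici (μ := η) (a := a)).symm,
        measureReal_congr (Ioi_ae_eq_Ici (μ := η) (a := b)).symm,
        ← measureReal_union (by
          rw [Set.disjoint_left]; intro x hx hx'; exact absurd hx.2 (not_le.2 hx'))
          measurableSet_Ioi, Ioc_union_Ioi_eq_Ioi hab]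
    rcases le_total 0 r with hr | hr
    · rw [intervalIntegral.integral_of_le hr, e 0 r hr]; simp
    · rw [intervalIntegral.integral_of_ge hr, e r 0 hr]; simp [add_comm]
  simp_rw [funext h2]
  fun_prop

/-- For a finite measure without atoms, the tail function carries the part of the measure on
`[t, ∞)` to Lebesgue measure on the interval `(0, η [t, ∞)]`. -/
theorem map_measureReal_Ici_restrict (t : ℝ) :
    (η.restrict (Ici t)).map (fun r => η.real (Ici r)) =
      volume.restrict (Ioc 0 (η.real (Ici t))) := by
  set φ : ℝ → ℝ := fun r => η.real (Ici r) with hφ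
  have hc : Continuous φ := continuous_measureReal_Ici η
  have ha : Antitone φ := antitone_measureReal_Ici η
  have h0 : ∀ r, 0 ≤ φ r := fun r => measureReal_nonneg
  have hof : ∀ r, η (Ici r) = ENNReal.ofReal (φ r) := fun r => by simp [hφ]
  refine Measure.ext_of_Iic _ _ fun a => ?_
  rw [Measure.map_apply hc.measurable measurableSet_Iic,
    Measure.restrict_apply (hc.measurable measurableSet_Iic),
    Measure.restrict_apply measurableSet_Iic]
  rcases lt_or_ge a 0 with ha0 | ha0
  · have e1 : φ ⁻¹' Iic a ∩ Ici t = ∅ := by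
      ext x; simp only [mem_inter_iff, mem_preimage, mem_Iic, mem_empty_iff_false, iff_false,
        not_and]
      intro h; linarith [h0 x]
    have e2 : Iic a ∩ Ioc 0 (φ t) = ∅ := by
      ext x; simp only [mem_inter_iff, mem_Iic, mem_Ioc, mem_empty_iff_false, iff_false]
      rintro ⟨h1, h2, _⟩; linarith
    rw [e1, e2]; simp
  rcases le_or_gt (φ t) a with hat | hat
  · have e1 : φ ⁻¹' Iic a ∩ Ici t = Ici t := by
      ext x; simp only [mem_inter_iff, mem_preimage, mem_Iic, mem_Ici, and_iff_right_iff_imp]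
      intro h; exact (ha h).trans hat
    have e2 : Iic a ∩ Ioc 0 (φ t) = Ioc 0 (φ t) := by
      ext x; simp only [mem_inter_iff, mem_Iic, mem_Ioc, and_iff_right_iff_imp]
      rintro ⟨_, h2⟩; linarith
    rw [e1, e2, hof]; simp
  · have e2 : Iic a ∩ Ioc 0 (φ t) = Ioc 0 a := by
      ext x; simp only [mem_inter_iff, mem_Iic, mem_Ioc]
      constructor
      · rintro ⟨h1, h2, _⟩; exact ⟨h2, h1⟩
      · rintro ⟨h1, h2⟩; exact ⟨h2, h1, by linarith⟩
    rw [e2, Real.volume_Ioc, sub_zero]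
    -- the sublevel set is a closed half-line on whose endpoint `φ` takes the value `a`
    have e1 : φ ⁻¹' Iic a ∩ Ici t = φ ⁻¹' Iic a := by
      ext x; simp only [mem_inter_iff, mem_preimage, mem_Iic, mem_Ici, and_iff_left_iff_imp]
      intro h; by_contra hx
      linarith [ha (not_le.1 hx).le]
    rw [e1]
    rcases ha0.eq_or_lt with rfl | hapos
    · -- the level `0`
      rw [ENNReal.ofReal_zero]
      by_cases hne : (φ ⁻¹' Iic 0).Nonempty
      · have hbdd : BddBelow (φ ⁻¹' Iic 0) := ⟨t, fun x hx => by
          by_contra hxt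
          have h1 : φ x ≤ 0 := hx
          linarith [ha (not_le.1 hxt).le]⟩
        have hmem := (isClosed_Iic.preimage hc).csInf_mem hne hbdd
        have : φ ⁻¹' Iic 0 ⊆ Ici (sInf (φ ⁻¹' Iic 0)) := fun x hx => csInf_le hbdd hx
        refine measure_mono_null this ?_
        rw [hof]
        simpa using hmem
      · rw [not_nonempty_iff_eq_empty.1 hne, measure_empty]
    · obtain ⟨s', hs'⟩ := ((tendsto_measureReal_Ici_atTop η).eventually_lt_const hapos).exists
      have hne : (φ ⁻¹' Iic a).Nonempty := ⟨s', hs'.le⟩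
      have hbdd : BddBelow (φ ⁻¹' Iic a) := ⟨t, fun x hx => by
          by_contra hxt
          have h1 : φ x ≤ a := hx
          linarith [ha (not_le.1 hxt).le]⟩
      have hmem : φ (sInf (φ ⁻¹' Iic a)) ≤ a :=
        (isClosed_Iic.preimage hc).csInf_mem hne hbdd
      set s := sInf (φ ⁻¹' Iic a)
      have hset : φ ⁻¹' Iic a = Ici s := by
        ext x
        exact ⟨fun hx => csInf_le hbdd hx, fun hx => (ha hx).trans hmem⟩
      have hval : φ s = a := by
        refine le_antisymm hmem ?_
        have hts : t ≤ s := by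
          by_contra hx; linarith [ha (not_le.1 hx).le]
        obtain ⟨r, hr, hra⟩ := intermediate_value_Icc' hts hc.continuousOn ⟨hmem, hat.le⟩
        have : s ≤ r := csInf_le hbdd hra.le
        rw [← hra]; exact ha this
      rw [hset, hof, hval]

/-- The chain rule for powers of the tail function, in integrated form. It needs no derivative of the
tail function: it is the integral of `H x ^ (H - 1)` over `(0, η [t, ∞)]`, transported back. -/
theorem measureReal_Ici_rpow {H : ℝ} (hH : 1 ≤ H) (t : ℝ) :
    ENNReal.ofReal (η.real (Ici t) ^ H) =
      ∫⁻ r in Ici t, ENNReal.ofReal (H * η.real (Ici r) ^ (H - 1)) ∂η := by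
  have hm : Measurable fun x : ℝ => ENNReal.ofReal (H * x ^ (H - 1)) := by fun_prop
  have h := lintegral_map (μ := η.restrict (Ici t)) hm (continuous_measureReal_Ici η).measurable
  rw [← h, map_measureReal_Ici_restrict, ← ofReal_integral_eq_lintegral_ofReal,
    ← intervalIntegral.integral_of_le measureReal_nonneg, intervalIntegral.integral_const_mul,
    integral_rpow (Or.inl (by linarith))]
  · have : H - 1 + 1 = H := by ring
    rw [this, Real.zero_rpow (by linarith)]; congr 1; field_simp; ring
  · rw [← IntegrableOn, ← intervalIntegrable_iff_integrableOn_Ioc_of_le measureReal_nonneg]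
    exact (intervalIntegral.intervalIntegrable_rpow' (by linarith)).const_mul _
  · filter_upwards [self_mem_ae_restrict measurableSet_Ioc] with x hx
    have : 0 < x := hx.1
    positivity

end

namespace PowerGrowth

variable {X : Type*} [MeasurableSpace X] {μ : Measure X} {ρ : X → ℝ} {V Q : ℝ} {u : X → ℝ≥0∞}

/-- The image of the mass `u μ` under the gauge, as a finite measure on the line without atoms. -/
theorem exists_radialMass (h : PowerGrowth μ ρ V Q) (hu : Measurable u)
    (hfin : ∫⁻ x, u x ∂μ ≠ ⊤) : ∃ η : Measure ℝ, IsFiniteMeasure η ∧ NullSingletonClass η ∧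
      (∀ r, (tailIntegral μ ρ u r).toReal = η.real (Ici r)) ∧
      ∀ (f : ℝ → ℝ≥0∞), Measurable f → ∀ s, MeasurableSet s →
        ∫⁻ r in s, f r ∂η = ∫⁻ x in ρ ⁻¹' s, f (ρ x) * u x ∂μ := by
  have hf : ∀ (f : ℝ → ℝ≥0∞), Measurable f → ∀ s, MeasurableSet s →
        ∫⁻ r in s, f r ∂((μ.withDensity u).map ρ) = ∫⁻ x in ρ ⁻¹' s, f (ρ x) * u x ∂μ := by
    intro f hf s hs
    rw [setLIntegral_map hs hf h.measurable]
    change ∫⁻ x in ρ ⁻¹' s, (f ∘ ρ) x ∂(μ.withDensity u) = _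
    rw [setLIntegral_withDensity_eq_setLIntegral_mul _ hu (hf.comp h.measurable) (h.measurable hs)]
    refine lintegral_congr fun x => ?_
    simp [mul_comm]
  have hs : ∀ s, MeasurableSet s → ((μ.withDensity u).map ρ) s = ∫⁻ x in ρ ⁻¹' s, u x ∂μ := by
    intro s hs
    have := hf (fun _ => 1) measurable_const s hs
    simpa using this
  refine ⟨(μ.withDensity u).map ρ, ⟨?_⟩, ⟨fun r => ?_⟩, fun r => ?_, hf⟩
  · rw [hs _ MeasurableSet.univ]; simpa using hfin.lt_top
  · rw [hs _ (measurableSet_singleton r)]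
    exact setLIntegral_measure_zero _ _ (h.measure_eq_const r)
  · rw [Measure.real, hs _ measurableSet_Ici]; rfl

theorem continuous_tailIntegral (h : PowerGrowth μ ρ V Q) (hu : Measurable u)
    (hfin : ∫⁻ x, u x ∂μ ≠ ⊤) : Continuous fun r => (tailIntegral μ ρ u r).toReal := by
  obtain ⟨η, _, _, hη, _⟩ := h.exists_radialMass hu hfin
  simp_rw [hη]
  exact continuous_measureReal_Ici η

/-- The chain rule for powers of the tail integral, in integrated form. -/
theorem tailIntegral_rpow (h : PowerGrowth μ ρ V Q) (hu : Measurable u)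
    (hfin : ∫⁻ x, u x ∂μ ≠ ⊤) {H : ℝ} (hH : 1 ≤ H) (t : ℝ) :
    tailIntegral μ ρ u t ^ H =
      ∫⁻ x in {x | t ≤ ρ x}, ENNReal.ofReal H * tailIntegral μ ρ u (ρ x) ^ (H - 1) * u x ∂μ := by
  obtain ⟨η, _, _, hη, hf⟩ := h.exists_radialMass hu hfin
  have hof : ∀ r, tailIntegral μ ρ u r = ENNReal.ofReal (η.real (Ici r)) := fun r => by
    rw [← hη, ENNReal.ofReal_toReal (tailIntegral_ne_top hfin r)]
  have hm : Measurable fun r => ENNReal.ofReal (H * η.real (Ici r) ^ (H - 1)) := by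
    have := (continuous_measureReal_Ici η).measurable
    fun_prop
  rw [hof, ENNReal.ofReal_rpow_of_nonneg measureReal_nonneg (by linarith),
    measureReal_Ici_rpow η hH t, hf _ hm _ measurableSet_Ici]
  refine lintegral_congr fun x => ?_
  rw [hof, ENNReal.ofReal_mul (by linarith),
    ENNReal.ofReal_rpow_of_nonneg measureReal_nonneg (by linarith)]

end PowerGrowth

/-! ### Monotone transport on the half-line -/

section

variable {F : ℝ → ℝ} {I : Set ℝ}

/-- `F` is an integrable density on the half-line, continuous and positive on the open set `I` and
zero off it, where `I` is `(0, ∞)` or an interval `(0, R)`. The fields `pos_of_mem` and `mem_of_le`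
give `I` this form without naming `R`. -/
structure IsInitialDensity (F : ℝ → ℝ) (I : Set ℝ) : Prop where
  isOpen : IsOpen I
  pos_of_mem : ∀ r ∈ I, 0 < r
  mem_of_le : ∀ r ∈ I, ∀ s, 0 < s → s ≤ r → s ∈ I
  integrable : Integrable F
  continuousAt : ∀ r ∈ I, ContinuousAt F r
  pos : ∀ r ∈ I, 0 < F r
  eq_zero : ∀ r ∉ I, F r = 0

namespace IsInitialDensity

theorem hasStrictDerivAt (h : IsInitialDensity F I) {r : ℝ} (hr : r ∈ I) :
    HasStrictDerivAt (fun r => ∫ x in (0 : ℝ)..r, F x) (F r) r :=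
  intervalIntegral.integral_hasStrictDerivAt_right h.integrable.intervalIntegrable
    h.integrable.aestronglyMeasurable.stronglyMeasurableAtFilter (h.continuousAt r hr)

theorem nonneg (h : IsInitialDensity F I) (r : ℝ) : 0 ≤ F r := by
  by_cases hr : r ∈ I
  · exact (h.pos r hr).le
  · exact (h.eq_zero r hr).ge

theorem strictMonoOn (h : IsInitialDensity F I) :
    StrictMonoOn (fun r => ∫ x in (0 : ℝ)..r, F x) I := by
  intro r hr s hs hrs
  have h1 : ∫ x in (0 : ℝ)..s, F x = (∫ x in (0 : ℝ)..r, F x) + ∫ x in r..s, F x :=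
    (intervalIntegral.integral_add_adjacent_intervals h.integrable.intervalIntegrable
      h.integrable.intervalIntegrable).symm
  have h2 : 0 < ∫ x in r..s, F x :=
    intervalIntegral.intervalIntegral_pos_of_pos_on h.integrable.intervalIntegrable
      (fun x hx => h.pos x (h.mem_of_le s hs x ((h.pos_of_mem r hr).trans hx.1) hx.2.le)) hrs
  simp only [h1]; linarith

theorem primitive_pos (h : IsInitialDensity F I) {r : ℝ} (hr : r ∈ I) :
    0 < ∫ x in (0 : ℝ)..r, F x :=
  intervalIntegral.intervalIntegral_pos_of_pos_on h.integrable.intervalIntegrable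
      (fun x hx => h.pos x (h.mem_of_le r hr x hx.1 hx.2.le)) (h.pos_of_mem r hr)

theorem primitive_lt (h : IsInitialDensity F I) {r : ℝ} (hr : r ∈ I) :
    ∫ x in (0 : ℝ)..r, F x < ∫ x in Ioi 0, F x := by
  obtain ⟨ε, hε, hball⟩ := Metric.isOpen_iff.1 h.isOpen r hr
  have hs : r + ε / 2 ∈ I := hball (by
    simp only [Metric.mem_ball, Real.dist_eq, add_sub_cancel_left, abs_of_pos (half_pos hε)]
    linarith)
  have h1 := h.strictMonoOn hr hs (by linarith)
  refine h1.trans_le ?_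
  have hpos := h.pos_of_mem _ hs
  simp only
  rw [intervalIntegral.integral_of_le hpos.le]
  exact setIntegral_mono_set h.integrable.integrableOn
    (Eventually.of_forall fun x => h.nonneg x) Ioc_subset_Ioi_self.eventuallyLE

theorem exists_primitive_eq (h : IsInitialDensity F I) {c : ℝ} (h0 : 0 < c)
    (h1 : c < ∫ x in Ioi 0, F x) : ∃ r ∈ I, ∫ x in (0 : ℝ)..r, F x = c := by
  have ht := intervalIntegral_tendsto_integral_Ioi 0 h.integrable.integrableOn tendsto_id
  obtain ⟨b, hb, hb0⟩ := ((ht.eventually_const_lt h1).and (eventually_ge_atTop 0)).exists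
  have hcont : Continuous fun r => ∫ x in (0 : ℝ)..r, F x :=
    intervalIntegral.continuous_primitive (fun _ _ => h.integrable.intervalIntegrable) 0
  obtain ⟨r, hr, hrc⟩ := intermediate_value_Icc hb0 hcont.continuousOn
    (show c ∈ Icc _ _ from ⟨by simpa using h0.le, hb.le⟩)
  refine ⟨r, ?_, hrc⟩
  by_contra hrI
  have hz : ∫ x in r..b, F x = 0 := by
    rw [intervalIntegral.integral_congr (g := fun _ => (0 : ℝ))]
    · simp
    · intro x hx
      rw [uIcc_of_le hr.2] at hx
      refine h.eq_zero x fun hxI => ?_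
      rcases hr.1.eq_or_lt with h0r | h0r
      · subst h0r; simp only [intervalIntegral.integral_same] at hrc; linarith
      · exact hrI (h.mem_of_le x hxI r h0r hx.1)
  have := intervalIntegral.integral_add_adjacent_intervals (a := 0) (b := r) (c := b) (f := F)
    (μ := volume) h.integrable.intervalIntegrable h.integrable.intervalIntegrable
  simp only [id] at hb hrc
  linarith

/-- The monotone map `T` that transports the density `F` to `k G`, where `k` is the ratio of the
masses. It is differentiable, and its derivative satisfies `F = k (G ∘ T) T'`. -/
theorem exists_transport {G : ℝ → ℝ} {J : Set ℝ} (hF : IsInitialDensity F I)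
    (hG : IsInitialDensity G J) {k : ℝ} (hk : 0 < k)
    (hmass : ∫ x in Ioi 0, F x = k * ∫ y in Ioi 0, G y) :
    ∃ T : ℝ → ℝ, Measurable T ∧ (∀ r ∈ I, T r ∈ J) ∧
      (∀ r ∈ I, HasDerivAt T (F r / (k * G (T r))) r) ∧
      StrictMonoOn T I ∧ T '' I = J := by
  set Φ : ℝ → ℝ := fun r => ∫ x in (0 : ℝ)..r, F x with hΦ
  set M : ℝ → ℝ := fun r => ∫ x in (0 : ℝ)..r, G x with hM
  suffices ∃ T : ℝ → ℝ, (∀ r ∈ I, T r ∈ J) ∧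
      (∀ r ∈ I, HasDerivAt T (F r / (k * G (T r))) r) ∧ StrictMonoOn T I ∧ T '' I = J by
    obtain ⟨T, hTJ, hT, hmono, himage⟩ := this
    classical
    have heq : EqOn (I.piecewise T 0) T I := piecewise_eqOn I T 0
    refine ⟨I.piecewise T 0, ?_, fun r hr => ?_, fun r hr => ?_, ?_, ?_⟩
    · exact ContinuousOn.measurable_piecewise
        (fun r hr => (hT r hr).continuousAt.continuousWithinAt) continuousOn_const
        hF.isOpen.measurableSet
    · rw [heq hr]; exact hTJ r hr
    · rw [heq hr]
      refine (hT r hr).congr_of_eventuallyEq ?_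
      filter_upwards [hF.isOpen.mem_nhds hr] with x hx using heq hx
    · exact hmono.congr heq.symm
    · rw [heq.image_eq, himage]
  set T : ℝ → ℝ := fun r => Function.invFunOn M J (Φ r / k)
  have hex : ∀ r ∈ I, ∃ y ∈ J, M y = Φ r / k := fun r hr =>
    hG.exists_primitive_eq (div_pos (hF.primitive_pos hr) hk) (by
      rw [div_lt_iff₀ hk, mul_comm, ← hmass]; exact hF.primitive_lt hr)
  have hTJ : ∀ r ∈ I, T r ∈ J := fun r hr => Function.invFunOn_mem (hex r hr)
  have hMT : ∀ r ∈ I, M (T r) = Φ r / k := fun r hr => Function.invFunOn_eq (hex r hr)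
  have hleft : ∀ y ∈ J, Function.invFunOn M J (M y) = y := fun y hy =>
    hG.strictMonoOn.injOn.leftInvOn_invFunOn hy
  refine ⟨T, hTJ, fun r hr => ?_, fun r hr s hs hrs => ?_, ?_⟩
  · have h1 : HasStrictDerivAt (Function.invFunOn M J) (G (T r))⁻¹ (M (T r)) :=
      (hG.hasStrictDerivAt (hTJ r hr)).to_local_left_inverse (hG.pos _ (hTJ r hr)).ne'
        (by filter_upwards [hG.isOpen.mem_nhds (hTJ r hr)] with y hy using hleft y hy)
    rw [hMT r hr] at h1
    have h2 := h1.hasDerivAt.comp r ((hF.hasStrictDerivAt hr).hasDerivAt.div_const k)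
    have e : F r / (k * G (T r)) = (G (T r))⁻¹ * (F r / k) := by
      rw [div_eq_mul_inv, mul_inv]; ring
    rw [e]; exact h2
  · rw [← hG.strictMonoOn.lt_iff_lt (hTJ r hr) (hTJ s hs)]
    change M (T r) < M (T s)
    rw [hMT r hr, hMT s hs]
    exact div_lt_div_of_pos_right (hF.strictMonoOn hr hs hrs) hk
  · ext y
    constructor
    · rintro ⟨r, hr, rfl⟩; exact hTJ r hr
    · intro hy
      obtain ⟨r, hr, hre⟩ := hF.exists_primitive_eq (mul_pos hk (hG.primitive_pos hy)) (by
        rw [hmass]; exact mul_lt_mul_of_pos_left (hG.primitive_lt hy) hk)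
      refine ⟨r, hr, ?_⟩
      have : Φ r / k = M y := by
        rw [hΦ]; simp only; rw [hre]; field_simp; rfl
      change Function.invFunOn M J (Φ r / k) = y
      rw [this, hleft y hy]

end IsInitialDensity

end

/-! ### The Beta integral and the change of variables -/

section

theorem lintegral_rpow_mul_exp {a r : ℝ} (ha : 0 < a) (hr : 0 < r) :
    ∫⁻ t in Ioi 0, ENNReal.ofReal (t ^ (a - 1) * Real.exp (-(r * t))) =
      ENNReal.ofReal (Real.Gamma a * r ^ (-a)) := by
  have h := Real.integral_rpow_mul_exp_neg_mul_Ioi ha hr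
  have h0 : Real.Gamma a * r ^ (-a) = (1 / r) ^ a * Real.Gamma a := by
    rw [Real.rpow_neg hr.le, one_div, Real.inv_rpow hr.le, mul_comm]
  have hG := Real.Gamma_pos_of_pos ha
  rw [h0, ← h, ofReal_integral_eq_lintegral_ofReal]
  · refine Integrable.of_integral_ne_zero ?_
    rw [h]; positivity
  · filter_upwards [self_mem_ae_restrict measurableSet_Ioi] with x hx
    have : 0 < x := hx
    positivity

/-- The Beta integral over the half-line. Multiplied by `Γ (a + d)`, the integral becomes a double
integral that Tonelli's theorem evaluates to `Γ a * Γ d`. -/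
theorem lintegral_rpow_mul_one_add_rpow {a d : ℝ} (ha : 0 < a) (hd : 0 < d) :
    ∫⁻ y in Ioi 0, ENNReal.ofReal (y ^ (a - 1) * (1 + y) ^ (-(a + d))) =
      ENNReal.ofReal (ProbabilityTheory.beta a d) := by
  have hGa := Real.Gamma_pos_of_pos ha
  have hGd := Real.Gamma_pos_of_pos hd
  have hGc := Real.Gamma_pos_of_pos (add_pos ha hd)
  have hc : 0 < a + d := add_pos ha hd
  have key : ENNReal.ofReal (Real.Gamma (a + d)) *
      ∫⁻ y in Ioi 0, ENNReal.ofReal (y ^ (a - 1) * (1 + y) ^ (-(a + d))) =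
      ENNReal.ofReal (Real.Gamma a * Real.Gamma d) := by
    have e1 : ∀ y ∈ Ioi (0 : ℝ), ENNReal.ofReal (Real.Gamma (a + d)) *
        ENNReal.ofReal (y ^ (a - 1) * (1 + y) ^ (-(a + d))) =
        ∫⁻ t in Ioi 0, ENNReal.ofReal
          (y ^ (a - 1) * (t ^ (a + d - 1) * Real.exp (-((1 + y) * t)))) := by
      intro y hy
      have hy : 0 < y := hy
      simp_rw [ENNReal.ofReal_mul (Real.rpow_nonneg hy.le (a - 1))]
      rw [lintegral_const_mul _ (by fun_prop), lintegral_rpow_mul_exp hc (by linarith),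
        ENNReal.ofReal_mul hGc.le]
      ring
    have e2 : ∀ t ∈ Ioi (0 : ℝ), ∫⁻ y in Ioi 0, ENNReal.ofReal
          (y ^ (a - 1) * (t ^ (a + d - 1) * Real.exp (-((1 + y) * t)))) =
        ENNReal.ofReal (Real.Gamma a) * ENNReal.ofReal (t ^ (d - 1) * Real.exp (-(1 * t))) := by
      intro t ht
      have ht : 0 < t := ht
      have : ∀ y, y ^ (a - 1) * (t ^ (a + d - 1) * Real.exp (-((1 + y) * t))) =
          (t ^ (a + d - 1) * Real.exp (-t)) * (y ^ (a - 1) * Real.exp (-(t * y))) := by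
        intro y
        rw [show -((1 + y) * t) = -t + -(t * y) by ring, Real.exp_add]; ring
      simp_rw [this, ENNReal.ofReal_mul (show 0 ≤ t ^ (a + d - 1) * Real.exp (-t) by positivity)]
      rw [lintegral_const_mul _ (by fun_prop), lintegral_rpow_mul_exp ha ht,
        ← ENNReal.ofReal_mul (by positivity), ← ENNReal.ofReal_mul hGa.le]
      congr 1
      rw [show a + d - 1 = (d - 1) + a by ring, Real.rpow_add ht, Real.rpow_neg ht.le, one_mul]
      field_simp
    rw [← lintegral_const_mul _ (by fun_prop), setLIntegral_congr_fun measurableSet_Ioi e1,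
      lintegral_lintegral_swap (by fun_prop), setLIntegral_congr_fun measurableSet_Ioi e2,
      lintegral_const_mul _ (by fun_prop), lintegral_rpow_mul_exp hd one_pos,
      ← ENNReal.ofReal_mul hGa.le]
    simp
  rw [ProbabilityTheory.beta, ENNReal.ofReal_div_of_pos hGc, ← key, mul_comm,
    ENNReal.mul_div_cancel_right (by simpa using hGc) ENNReal.ofReal_ne_top]

theorem beta_add_one_left {a d : ℝ} (ha : 0 < a) (hd : 0 < d) :
    d * ProbabilityTheory.beta (a + 1) d = a * ProbabilityTheory.beta a (d + 1) := by
  unfold ProbabilityTheory.beta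
  rw [Real.Gamma_add_one ha.ne', Real.Gamma_add_one hd.ne',
    show a + 1 + d = a + (d + 1) by ring]
  ring

theorem beta_eq_mul_beta_add_one {a d : ℝ} (ha : 0 < a) (hd : 0 < d) :
    d * ProbabilityTheory.beta a d = (a + d) * ProbabilityTheory.beta a (d + 1) := by
  have := Real.Gamma_pos_of_pos (add_pos ha hd)
  unfold ProbabilityTheory.beta
  rw [← add_assoc, Real.Gamma_add_one hd.ne', Real.Gamma_add_one (add_pos ha hd).ne']
  field_simp

end

namespace IsInitialDensity
variable {F : ℝ → ℝ} {I : Set ℝ}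

/-- The change of variables under a transport map. -/
theorem lintegral_transport {G : ℝ → ℝ} {J : Set ℝ} (hF : IsInitialDensity F I)
    (hG : IsInitialDensity G J) {k : ℝ} (hk : 0 < k) {T : ℝ → ℝ} (hTJ : ∀ r ∈ I, T r ∈ J)
    (hT : ∀ r ∈ I, HasDerivAt T (F r / (k * G (T r))) r) (hmono : StrictMonoOn T I)
    (himage : T '' I = J) (w : ℝ → ℝ≥0∞) :
    ∫⁻ r in I, ENNReal.ofReal (F r) * w (T r) =
      ENNReal.ofReal k * ∫⁻ y in J, ENNReal.ofReal (G y) * w y := by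
  rw [← lintegral_const_mul' _ _ ENNReal.ofReal_ne_top, ← himage,
    lintegral_image_eq_lintegral_abs_deriv_mul hF.isOpen.measurableSet
      (fun r hr => (hT r hr).hasDerivWithinAt) hmono.injOn]
  refine setLIntegral_congr_fun hF.isOpen.measurableSet fun r hr => ?_
  have h1 := hF.pos r hr
  have h2 := hG.pos _ (hTJ r hr)
  rw [abs_of_pos (by positivity), ← mul_assoc, ← mul_assoc, ← ENNReal.ofReal_mul (by positivity),
    ← ENNReal.ofReal_mul (by positivity)]
  congr 2
  field_simp

end IsInitialDensity

/-! ### Tonelli and Hölder for tails -/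

namespace PowerGrowth

variable {X : Type*} [MeasurableSpace X] {μ : Measure X} {ρ : X → ℝ} {V Q : ℝ} {u : X → ℝ≥0∞}

theorem lintegral_tailIntegral_rpow_mul (h : PowerGrowth μ ρ V Q) (hu : Measurable u)
    (hfin : ∫⁻ x, u x ∂μ ≠ ⊤) {H : ℝ} (hH : 1 ≤ H) {w : ℝ → ℝ≥0∞} (hw : Measurable w) :
    ∫⁻ r in Ioi 0, tailIntegral μ ρ u r ^ H * w r =
      ENNReal.ofReal H * ∫⁻ x, tailIntegral μ ρ u (ρ x) ^ (H - 1) *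
        (∫⁻ r in Ioc 0 (ρ x), w r) * u x ∂μ := by
  have := h.sigmaFinite
  have hρ := h.measurable
  have hφ := measurable_tailIntegral μ ρ u
  set g : X → ℝ≥0∞ := fun x =>
    ENNReal.ofReal H * tailIntegral μ ρ u (ρ x) ^ (H - 1) * u x with hg
  have hgm : Measurable g := by fun_prop
  have e1 : ∀ r, tailIntegral μ ρ u r ^ H * w r =
      ∫⁻ x, {z : ℝ × X | z.1 ≤ ρ z.2}.indicator (fun z => w z.1 * g z.2) (r, x) ∂μ := by
    intro r
    rw [h.tailIntegral_rpow hu hfin hH r, mul_comm, ← lintegral_const_mul _ hgm,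
      ← lintegral_indicator (measurableSet_le measurable_const hρ)]
    rfl
  have hm : Measurable ({z : ℝ × X | z.1 ≤ ρ z.2}.indicator (fun z => w z.1 * g z.2)) :=
    Measurable.indicator (by fun_prop)
      (measurableSet_le measurable_fst (hρ.comp measurable_snd))
  simp_rw [e1]
  rw [lintegral_lintegral_swap (f := fun r x =>
      {z : ℝ × X | z.1 ≤ ρ z.2}.indicator (fun z => w z.1 * g z.2) (r, x)) hm.aemeasurable,
    ← lintegral_const_mul' _ _ ENNReal.ofReal_ne_top]
  refine lintegral_congr fun x => ?_
  have e2 : ∀ r, {z : ℝ × X | z.1 ≤ ρ z.2}.indicator (fun z => w z.1 * g z.2) (r, x) =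
      g x * (Iic (ρ x)).indicator w r := by
    intro r
    by_cases hr : r ≤ ρ x
    · rw [indicator_of_mem (show (r, x) ∈ {z : ℝ × X | z.1 ≤ ρ z.2} from hr),
        indicator_of_mem (show r ∈ Iic (ρ x) from hr), mul_comm]
    · rw [indicator_of_notMem (show (r, x) ∉ {z : ℝ × X | z.1 ≤ ρ z.2} from hr),
        indicator_of_notMem (show r ∉ Iic (ρ x) from hr), mul_zero]
  simp_rw [e2]
  rw [lintegral_const_mul _ (hw.indicator measurableSet_Iic), lintegral_indicator measurableSet_Iic,
    Measure.restrict_restrict measurableSet_Iic, inter_comm, Ioi_inter_Iic]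
  simp only [hg]
  ring

/-- Hölder's inequality against the weight `ρ ^ α`, with the conjugate factor written in polar
coordinates. -/
theorem lintegral_comp_mul_le (h : PowerGrowth μ ρ V Q) (hu : Measurable u) {p p' : ℝ}
    (hp : p.HolderConjugate p') (α : ℝ) {f : ℝ → ℝ≥0∞} (hf : Measurable f) :
    ∫⁻ x, f (ρ x) * u x ∂μ ≤ weightedEnergy μ ρ p α u ^ (1 / p) *
      (∫⁻ r in Ioi 0, ENNReal.ofReal (Q * V * r ^ (Q - 1)) *
        (f r ^ p' * ENNReal.ofReal (r ^ (-(α / p * p'))))) ^ (1 / p') := by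
  have hρ := h.measurable
  have h1 : ∫⁻ x, f (ρ x) * u x ∂μ =
      ∫⁻ x, ((fun x => u x * ENNReal.ofReal (ρ x ^ (α / p))) *
        (fun x => f (ρ x) * ENNReal.ofReal (ρ x ^ (-(α / p))))) x ∂μ := by
    refine lintegral_congr_ae ?_
    filter_upwards [h.ae_pos] with x hx
    have : ENNReal.ofReal (ρ x ^ (α / p)) * ENNReal.ofReal (ρ x ^ (-(α / p))) = 1 := by
      rw [← ENNReal.ofReal_mul (by positivity), ← Real.rpow_add hx]; simp
    simp only [Pi.mul_apply]
    rw [show u x * ENNReal.ofReal (ρ x ^ (α / p)) * (f (ρ x) * ENNReal.ofReal (ρ x ^ (-(α / p)))) =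
      (ENNReal.ofReal (ρ x ^ (α / p)) * ENNReal.ofReal (ρ x ^ (-(α / p)))) * (f (ρ x) * u x) by ring,
      this, one_mul]
  rw [h1]
  refine (ENNReal.lintegral_mul_le_Lp_mul_Lq μ hp (by fun_prop) (by fun_prop)).trans ?_
  refine mul_le_mul' (le_of_eq ?_) (le_of_eq ?_)
  · congr 1
    refine lintegral_congr fun x => ?_
    have := h.nonneg x
    rw [ENNReal.mul_rpow_of_nonneg _ _ hp.nonneg, ENNReal.ofReal_rpow_of_nonneg (by positivity)
      hp.nonneg, ← Real.rpow_mul this, div_mul_cancel₀ _ hp.ne_zero]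
  · congr 1
    rw [← h.lintegral_comp (f := fun r => f r ^ p' * ENNReal.ofReal (r ^ (-(α / p * p'))))
      (by fun_prop)]
    refine lintegral_congr fun x => ?_
    have := h.nonneg x
    rw [ENNReal.mul_rpow_of_nonneg _ _ hp.symm.nonneg,
      ENNReal.ofReal_rpow_of_nonneg (by positivity) hp.symm.nonneg, ← Real.rpow_mul this, neg_mul]

/-- The integral of a power of the tails against a density `w` with primitive at most `W` is
controlled by the energy of `u`: apply the chain rule, exchange the integrals, and use Hölder. -/
theorem lintegral_tailIntegral_rpow_mul_le (h : PowerGrowth μ ρ V Q) (hu : Measurable u)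
    (hfin : ∫⁻ x, u x ∂μ ≠ ⊤) {H : ℝ} (hH : 1 < H) {p p' : ℝ} (hp : p.HolderConjugate p') (α : ℝ)
    {w W : ℝ → ℝ≥0∞} (hw : Measurable w) (hW : Measurable W)
    (hwW : ∀ t, 0 < t → tailIntegral μ ρ u t ≠ 0 → ∫⁻ r in Ioc 0 t, w r ≤ W t) :
    ∫⁻ r in Ioi 0, tailIntegral μ ρ u r ^ H * w r ≤
      ENNReal.ofReal H * (weightedEnergy μ ρ p α u ^ (1 / p) *
      (∫⁻ r in Ioi 0, ENNReal.ofReal (Q * V * r ^ (Q - 1)) *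
        ((tailIntegral μ ρ u r ^ (H - 1) * W r) ^ p' *
          ENNReal.ofReal (r ^ (-(α / p * p'))))) ^ (1 / p')) := by
  rw [h.lintegral_tailIntegral_rpow_mul hu hfin hH.le hw]
  have hφ := measurable_tailIntegral μ ρ u
  refine mul_le_mul' le_rfl (le_trans ?_ (h.lintegral_comp_mul_le hu hp α
    (f := fun r => tailIntegral μ ρ u r ^ (H - 1) * W r) (by fun_prop)))
  refine lintegral_mono_ae ?_
  filter_upwards [h.ae_pos] with x hx
  refine mul_le_mul' ?_ le_rfl
  by_cases h0 : tailIntegral μ ρ u (ρ x) = 0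
  · rw [h0, ENNReal.zero_rpow_of_pos (by linarith)]; simp
  · exact mul_le_mul' le_rfl (hwW _ hx h0)

end PowerGrowth

/-! ### Bliss's inequality -/

/-- The pointwise inequality behind Bliss's inequality. The last bracket contains `r T' / T` for a
transport map `T` from `φ ^ q r ^ (b - 1)` to `k (1 + y) ^ (-n) y ^ (b - 1)`, where
`n = p (m + 1)`, `q = n / m`, `b = (p - 1) (m + 1)`. With `z` for that quantity, the inequality is an
identity except for the step `z ^ (1 / n) ≤ (n - 1 + z) / n`, the inequality of arithmetic and
geometric means. -/
theorem bliss_pointwise {p m φ r T k : ℝ} (hp : 1 < p) (hm : 0 < m) (hφ : 0 < φ) (hr : 0 < r)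
    (hT : 0 < T) (hk : 0 < k) :
    (1 + T) * (φ ^ (p * (m + 1) / m) * r ^ ((p - 1) * (m + 1) - 1)) ≤
      k ^ (1 / (p * (m + 1))) / (p * (m + 1)) * (φ ^ ((p - 1) * (m + 1) / m + 1) *
        (r ^ ((p * (m + 1) - 1) * ((p - 1) / p) - 1) * T ^ ((p - 1) / p) *
          ((p * (m + 1) - 1) +
            r * (φ ^ (p * (m + 1) / m) * r ^ ((p - 1) * (m + 1) - 1) /
              (k * (T ^ ((p - 1) * (m + 1) - 1) * (1 + T) ^ (-(p * (m + 1)))))) / T))) := by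
  have hn : 1 < p * (m + 1) := by nlinarith
  set n := p * (m + 1) with hndef
  set z := r * (φ ^ (n / m) * r ^ ((p - 1) * (m + 1) - 1) /
              (k * (T ^ ((p - 1) * (m + 1) - 1) * (1 + T) ^ (-n)))) / T with hz
  have hzpos : 0 < z := by positivity
  have hamgm : z ^ (1 / n) ≤ ((n - 1) + z) / n := by
    have := Real.geom_mean_le_arith_mean2_weighted (w₁ := 1 / n) (w₂ := 1 - 1 / n)
      (p₁ := z) (p₂ := 1) (by positivity) (by rw [sub_nonneg, div_le_one] <;> linarith) hzpos.le
      zero_le_one (by ring)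
    rw [Real.one_rpow, mul_one] at this
    refine this.trans (le_of_eq ?_)
    field_simp; ring
  have heq : (1 + T) * (φ ^ (n / m) * r ^ ((p - 1) * (m + 1) - 1)) =
      k ^ (1 / n) * (φ ^ ((p - 1) * (m + 1) / m + 1) *
        (r ^ ((n - 1) * ((p - 1) / p) - 1) * T ^ ((p - 1) / p) * z ^ (1 / n))) := by
    obtain ⟨a, rfl⟩ : ∃ a, φ = Real.exp a := ⟨_, (Real.exp_log hφ).symm⟩
    obtain ⟨c, rfl⟩ : ∃ a, r = Real.exp a := ⟨_, (Real.exp_log hr).symm⟩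
    obtain ⟨κ, rfl⟩ : ∃ a, k = Real.exp a := ⟨_, (Real.exp_log hk).symm⟩
    obtain ⟨d, hd⟩ : ∃ a, 1 + T = Real.exp a := ⟨_, (Real.exp_log (by linarith)).symm⟩
    rw [hz, hd]
    obtain ⟨t, rfl⟩ : ∃ a, T = Real.exp a := ⟨_, (Real.exp_log hT).symm⟩
    simp only [← Real.exp_mul, ← Real.exp_add, ← Real.exp_sub]
    congr 1
    rw [hndef]
    field_simp
    ring
  rw [heq]
  calc _ ≤ k ^ (1 / n) * (φ ^ ((p - 1) * (m + 1) / m + 1) *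
        (r ^ ((n - 1) * ((p - 1) / p) - 1) * T ^ ((p - 1) / p) * (((n - 1) + z) / n))) := by gcongr
    _ = _ := by ring

theorem hasDerivAt_rpow_mul_rpow {T : ℝ → ℝ} {T' r : ℝ} (a s : ℝ) (hr : 0 < r) (hT : 0 < T r)
    (h : HasDerivAt T T' r) :
    HasDerivAt (fun r => r ^ (a * s) * T r ^ s)
      (s * (r ^ (a * s - 1) * T r ^ s * (a + r * T' / T r))) r := by
  have h1 : HasDerivAt (fun r : ℝ => r ^ (a * s)) ((a * s) * r ^ (a * s - 1)) r :=
    Real.hasDerivAt_rpow_const (Or.inl hr.ne')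
  have h2 : HasDerivAt (fun r => T r ^ s) (T' * s * T r ^ (s - 1)) r :=
    h.rpow_const (Or.inl hT.ne')
  have h3 := h1.mul h2
  have e1 : T r ^ (s - 1) = T r ^ s / T r := by rw [Real.rpow_sub_one hT.ne']
  have e2 : r ^ (a * s - 1) = r ^ (a * s) / r := by rw [Real.rpow_sub_one hr.ne']
  have e : s * (r ^ (a * s - 1) * T r ^ s * (a + r * T' / T r)) =
      (a * s) * r ^ (a * s - 1) * T r ^ s + r ^ (a * s) * (T' * s * T r ^ (s - 1)) := by
    rw [e1, e2]; field_simp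
  rw [e]; exact h3

section
variable {X : Type*} [MeasurableSpace X] {μ : Measure X} {ρ : X → ℝ} {V Q : ℝ} {u : X → ℝ≥0∞}

theorem PowerGrowth.tailEnergy_eq (h : PowerGrowth μ ρ V Q) (u : X → ℝ≥0∞) (q β : ℝ) :
    tailEnergy μ ρ q β u = ENNReal.ofReal (Q * V) *
      ∫⁻ r in Ioi 0, tailIntegral μ ρ u r ^ q * ENNReal.ofReal (r ^ (β + Q - 1)) := by
  have hφ := measurable_tailIntegral μ ρ u
  unfold tailEnergy
  have hV := h.const_pos
  have hQ := h.dim_pos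
  rw [h.lintegral_comp (f := fun r => tailIntegral μ ρ u r ^ q * ENNReal.ofReal (r ^ β))
    (by fun_prop), ← lintegral_const_mul' _ _ ENNReal.ofReal_ne_top]
  refine setLIntegral_congr_fun measurableSet_Ioi fun r hr => ?_
  have hr : 0 < r := hr
  rw [show β + Q - 1 = (Q - 1) + β by ring, Real.rpow_add hr, ENNReal.ofReal_mul (by positivity),
    ENNReal.ofReal_mul (p := r ^ (Q - 1)) (by positivity)]
  ring

end

section
variable {X : Type*} [MeasurableSpace X] {μ : Measure X} {ρ : X → ℝ} {V Q : ℝ} {u : X → ℝ≥0∞}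

/-- The Beta density on the half-line, target of the transport. -/
theorem isInitialDensity_beta {b d : ℝ} (hb : 0 < b) (hd : 0 < d) :
    IsInitialDensity ((Ioi 0).indicator fun y => y ^ (b - 1) * (1 + y) ^ (-(b + d))) (Ioi 0) where
  isOpen := isOpen_Ioi
  pos_of_mem _ hr := hr
  mem_of_le _ _ _ hs _ := hs
  integrable := by
    rw [integrable_indicator_iff measurableSet_Ioi]
    refine ⟨by fun_prop, ?_⟩
    rw [hasFiniteIntegral_iff_ofReal, lintegral_rpow_mul_one_add_rpow hb hd]
    · exact ENNReal.ofReal_lt_top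
    · filter_upwards [self_mem_ae_restrict measurableSet_Ioi] with x hx
      have : 0 < x := hx
      positivity
  continuousAt r hr := by
    have hr : 0 < r := hr
    have h1 : ContinuousAt (fun y : ℝ => y ^ (b - 1) * (1 + y) ^ (-(b + d))) r :=
      (Real.continuousAt_rpow_const _ _ (Or.inl hr.ne')).mul
        ((continuousAt_const.add continuousAt_id).rpow_const (Or.inl (by simp; linarith)))
    refine h1.congr ?_
    filter_upwards [isOpen_Ioi.mem_nhds hr] with x hx
    rw [indicator_of_mem hx]
  pos r hr := by
    have hr' : 0 < r := hr
    rw [indicator_of_mem hr]; positivity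
  eq_zero r hr := indicator_of_notMem hr _

/-- The density `φ ^ q r ^ (b - 1)` built from the tails `φ` of a function that vanishes outside a
ball, source of the transport. -/
theorem PowerGrowth.isInitialDensity_tail (h : PowerGrowth μ ρ V Q) (hu : Measurable u)
    (hfin : ∫⁻ x, u x ∂μ ≠ ⊤) {R : ℝ} (hR : ∀ x, R ≤ ρ x → u x = 0) {q b : ℝ} (hq : 0 < q)
    (hb : 0 < b) :
    IsInitialDensity ((Ioi 0).indicator fun r => (tailIntegral μ ρ u r).toReal ^ q * r ^ (b - 1))
      {r | 0 < r ∧ 0 < (tailIntegral μ ρ u r).toReal} := by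
  have hφc := h.continuous_tailIntegral hu hfin
  have hanti : Antitone fun r => (tailIntegral μ ρ u r).toReal := fun r s hrs =>
    ENNReal.toReal_mono (tailIntegral_ne_top hfin r) (tailIntegral_antitone μ ρ u hrs)
  set φ : ℝ → ℝ := fun r => (tailIntegral μ ρ u r).toReal with hφ
  have hzero : ∀ r, R ≤ r → φ r = 0 := by
    intro r hr
    have : tailIntegral μ ρ u r = 0 := by
      unfold tailIntegral
      rw [setLIntegral_congr_fun (g := fun _ => 0) (measurableSet_le measurable_const h.measurable)]
      · simp
      · intro x hx; exact hR x (hr.trans hx)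
    simp [hφ, this]
  have h0 : ∀ r, 0 ≤ φ r := fun r => ENNReal.toReal_nonneg
  refine ⟨?_, fun r hr => hr.1, fun r hr s hs hsr => ⟨hs, hr.2.trans_le (hanti hsr)⟩, ?_,
    fun r hr => ?_, fun r hr => ?_, fun r hr => ?_⟩
  · exact isOpen_Ioi.inter (isOpen_Ioi.preimage hφc)
  · rw [integrable_indicator_iff measurableSet_Ioi]
    have hm : Measurable fun r : ℝ => φ r ^ q * r ^ (b - 1) := by
      have := hφc.measurable
      fun_prop
    have hdom : IntegrableOn (fun r : ℝ => φ 0 ^ q * r ^ (b - 1)) (Ioc 0 (max R 0)) := by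
      rw [← intervalIntegrable_iff_integrableOn_Ioc_of_le (le_max_right _ _)]
      exact (intervalIntegral.intervalIntegrable_rpow' (by linarith)).const_mul _
    have hI : IntegrableOn (fun r : ℝ => φ r ^ q * r ^ (b - 1)) (Ioc 0 (max R 0)) := by
      refine Integrable.mono' hdom hm.aestronglyMeasurable ?_
      filter_upwards [self_mem_ae_restrict measurableSet_Ioc] with r hr
      have hr0 : 0 < r := hr.1
      rw [Real.norm_of_nonneg (by have := h0 r; positivity)]
      gcongr
      exact hanti hr.1.le
    refine hI.of_forall_sdiff_eq_zero measurableSet_Ioi fun r hr => ?_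
    have hr1 : 0 < r := hr.1
    have : R ≤ r := by
      by_contra hlt
      exact hr.2 ⟨hr1, (not_le.1 hlt).le.trans (le_max_left _ _)⟩
    rw [hzero r this, Real.zero_rpow hq.ne', zero_mul]
  · have h1 : ContinuousAt (fun r : ℝ => φ r ^ q * r ^ (b - 1)) r :=
      (hφc.continuousAt.rpow_const (Or.inl hr.2.ne')).mul
        (Real.continuousAt_rpow_const _ _ (Or.inl hr.1.ne'))
    refine h1.congr ?_
    filter_upwards [isOpen_Ioi.mem_nhds hr.1] with x hx
    rw [indicator_of_mem hx]
  · rw [indicator_of_mem (show r ∈ Ioi 0 from hr.1)]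
    have h1 := hr.1
    have h2 : 0 < φ r := hr.2
    change 0 < φ r ^ q * r ^ (b - 1)
    positivity
  · by_cases hr0 : 0 < r
    · have : φ r = 0 := le_antisymm (not_lt.1 fun hlt => hr ⟨hr0, hlt⟩) (h0 r)
      rw [indicator_of_mem (show r ∈ Ioi 0 from hr0)]
      change φ r ^ q * r ^ (b - 1) = 0
      rw [this, Real.zero_rpow hq.ne', zero_mul]
    · exact indicator_of_notMem hr0 _

end

/-- The sharp constant of `PowerGrowth.bliss`, with `A` in the place of the area of the unit sphere.
Here `m / (p (m + 1))` is `1 / q` and `(p - 1) / p` is `1 / p'`. -/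
noncomputable def blissConst (A p m : ℝ) : ℝ :=
  A ^ (m / (p * (m + 1)) + (p - 1) / p) *
    ProbabilityTheory.beta ((p - 1) * (m + 1)) (m + 1) ^ (m / (p * (m + 1))) *
    ProbabilityTheory.beta ((p - 1) * (m + 1) + 1) m ^ (-(1 / p)) / m

theorem blissConst_pos {A p m : ℝ} (hA : 0 < A) (hp : 1 < p) (hm : 0 < m) :
    0 < blissConst A p m := by
  have hb : 0 < (p - 1) * (m + 1) := mul_pos (by linarith) (by linarith)
  have h1 := ProbabilityTheory.beta_pos hb (show 0 < m + 1 by linarith)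
  have h2 := ProbabilityTheory.beta_pos (show 0 < (p - 1) * (m + 1) + 1 by linarith) hm
  unfold blissConst
  positivity

/-- The transport estimate, in which the unknown `k` appears on both sides with different powers,
solved for `k`. -/
theorem rpow_le_blissConst_mul {A p m k e : ℝ} (hA : 0 < A) (hp : 1 < p) (hm : 0 < m) (hk : 0 < k)
    (h : k * ProbabilityTheory.beta ((p - 1) * (m + 1)) m ≤
      k ^ (1 / (p * (m + 1))) / ((p - 1) * (m + 1)) * (((p - 1) * (m + 1) / m + 1) *
        (e * (A * (k * ProbabilityTheory.beta ((p - 1) * (m + 1) + 1) m)) ^ ((p - 1) / p)))) :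
    (A * (k * ProbabilityTheory.beta ((p - 1) * (m + 1)) (m + 1))) ^ (m / (p * (m + 1))) ≤
      blissConst A p m * e := by
  have hb : 0 < (p - 1) * (m + 1) := mul_pos (by linarith) (by linarith)
  unfold blissConst
  set b := (p - 1) * (m + 1) with hbdef
  set B0 := ProbabilityTheory.beta b (m + 1) with hB0
  set B1 := ProbabilityTheory.beta b m with hB1
  set B2 := ProbabilityTheory.beta (b + 1) m with hB2
  have p0 : 0 < B0 := ProbabilityTheory.beta_pos hb (by linarith)
  have p2 : 0 < B2 := ProbabilityTheory.beta_pos (by linarith) hm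
  have r1 : m * B1 = (b + m) * B0 := beta_eq_mul_beta_add_one hb hm
  have r2 : m * B2 = b * B0 := beta_add_one_left hb hm
  have e1 : B1 = (b + m) / b * B2 := by
    field_simp
    have : m * (B1 * b) = m * ((b + m) * B2) := by
      linear_combination b * r1 - (b + m) * r2
    exact mul_left_cancel₀ hm.ne' this
  -- after cancelling the common factor `(b + m) / b`
  have h1 : k * B2 ≤ k ^ (1 / (p * (m + 1))) / m * (e * (A * (k * B2)) ^ ((p - 1) / p)) := by
    rw [e1] at h
    have hpos : 0 < (b + m) / b := by positivity
    refine le_of_mul_le_mul_left ?_ hpos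
    calc (b + m) / b * (k * B2) = k * ((b + m) / b * B2) := by ring
      _ ≤ _ := h
      _ = _ := by field_simp
  have hp0 : 0 < p := by linarith
  have hsplit : k * B2 = (k ^ (1 / (p * (m + 1))) * (k * B2) ^ ((p - 1) / p)) *
      (k ^ (m / (p * (m + 1))) * B2 ^ (1 / p)) := by
    rw [Real.mul_rpow hk.le p2.le]
    have a1 : k ^ (1 / (p * (m + 1))) * k ^ ((p - 1) / p) * k ^ (m / (p * (m + 1))) = k := by
      rw [← Real.rpow_add hk, ← Real.rpow_add hk]
      conv_rhs => rw [← Real.rpow_one k]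
      congr 1; field_simp; ring
    have a2 : B2 ^ ((p - 1) / p) * B2 ^ (1 / p) = B2 := by
      rw [← Real.rpow_add p2]
      conv_rhs => rw [← Real.rpow_one B2]
      congr 1; field_simp; ring
    calc k * B2 = (k ^ (1 / (p * (m + 1))) * k ^ ((p - 1) / p) * k ^ (m / (p * (m + 1)))) *
          (B2 ^ ((p - 1) / p) * B2 ^ (1 / p)) := by rw [a1, a2]
      _ = _ := by ring
  have h2 : k ^ (m / (p * (m + 1))) * B2 ^ (1 / p) ≤ A ^ ((p - 1) / p) / m * e := by
    rw [Real.mul_rpow hA.le (by positivity)] at h1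
    have hpos : 0 < k ^ (1 / (p * (m + 1))) * (k * B2) ^ ((p - 1) / p) := by positivity
    refine le_of_mul_le_mul_left ?_ hpos
    calc _ = k * B2 := hsplit.symm
      _ ≤ _ := h1
      _ = _ := by ring
  have h3 : k ^ (m / (p * (m + 1))) ≤ A ^ ((p - 1) / p) / m * e * B2 ^ (-(1 / p)) := by
    rw [Real.rpow_neg p2.le, ← div_eq_mul_inv, le_div_iff₀ (by positivity)]
    exact h2
  rw [Real.mul_rpow hA.le (by positivity), Real.mul_rpow hk.le p0.le, Real.rpow_add hA]
  calc _ = A ^ (m / (p * (m + 1))) * B0 ^ (m / (p * (m + 1))) * k ^ (m / (p * (m + 1))) := by ring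
    _ ≤ A ^ (m / (p * (m + 1))) * B0 ^ (m / (p * (m + 1))) *
        (A ^ ((p - 1) / p) / m * e * B2 ^ (-(1 / p))) := by gcongr
    _ = _ := by ring

section
variable {X : Type*} [MeasurableSpace X] {μ : Measure X} {ρ : X → ℝ} {V Q : ℝ} {u : X → ℝ≥0∞}

/-- The transport estimate. For a transport map `T` from the density `F` of the tails of `u` to `k G`,
the pointwise inequality `bliss_pointwise` bounds `(1 + T) F` by a power of the tail times the
derivative of `r ^ (a s) T ^ s`, and `lintegral_tailIntegral_rpow_mul_le` bounds the integral of that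
product by the energy. The powers of `r` in the Hölder factor combine to `F T` again. -/
theorem PowerGrowth.tail_integral_transport_le (h : PowerGrowth μ ρ V Q) (hu : Measurable u)
    (hfin : ∫⁻ x, u x ∂μ ≠ ⊤) {p m k : ℝ} (hp : 1 < p) (hm : 0 < m) (hk : 0 < k)
    {F G T : ℝ → ℝ} {I : Set ℝ}
    (hFdef : F = (Ioi 0).indicator fun r =>
      (tailIntegral μ ρ u r).toReal ^ (p * (m + 1) / m) * r ^ ((p - 1) * (m + 1) - 1))
    (hGdef : G = (Ioi 0).indicator fun y =>
      y ^ ((p - 1) * (m + 1) - 1) * (1 + y) ^ (-((p - 1) * (m + 1) + (m + 1))))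
    (hIdef : I = {r | 0 < r ∧ 0 < (tailIntegral μ ρ u r).toReal})
    (hF : IsInitialDensity F I) (hTm : Measurable T)
    (hTpos : ∀ r ∈ I, 0 < T r) (hT : ∀ r ∈ I, HasDerivAt T (F r / (k * G (T r))) r)
    (hmono : StrictMonoOn T I) :
    ∫⁻ r in I, ENNReal.ofReal (F r) * ENNReal.ofReal (1 + T r) ≤
      ENNReal.ofReal (k ^ (1 / (p * (m + 1))) / ((p - 1) * (m + 1))) *
      (ENNReal.ofReal ((p - 1) * (m + 1) / m + 1) *
        (weightedEnergy μ ρ p ((p - 1) * (m + Q)) u ^ (1 / p) *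
          (ENNReal.ofReal (Q * V) * ∫⁻ r in I, ENNReal.ofReal (F r) * ENNReal.ofReal (T r)) ^
            ((p - 1) / p))) := by
  have hp0 : 0 < p := by linarith
  have hb : 0 < (p - 1) * (m + 1) := mul_pos (by linarith) (by linarith)
  have hn : (p - 1) * (m + 1) + (m + 1) = p * (m + 1) := by ring
  have hQ := h.dim_pos
  have hV := h.const_pos
  have hIm : MeasurableSet I := hF.isOpen.measurableSet
  have hφm := measurable_tailIntegral μ ρ u
  set φ : ℝ → ℝ := fun r => (tailIntegral μ ρ u r).toReal with hφ
  have hφof : ∀ r, tailIntegral μ ρ u r = ENNReal.ofReal (φ r) := fun r =>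
    (ENNReal.ofReal_toReal (tailIntegral_ne_top hfin r)).symm
  have hI0 : ∀ r ∈ I, 0 < r := fun r hr => by rw [hIdef] at hr; exact hr.1
  have hIφ : ∀ r ∈ I, 0 < φ r := fun r hr => by rw [hIdef] at hr; exact hr.2
  have hFI : ∀ r ∈ I, F r = φ r ^ (p * (m + 1) / m) * r ^ ((p - 1) * (m + 1) - 1) :=
    fun r hr => by rw [hFdef, indicator_of_mem (show r ∈ Ioi 0 from hI0 r hr)]
  have hGT : ∀ r ∈ I, G (T r) =
      T r ^ ((p - 1) * (m + 1) - 1) * (1 + T r) ^ (-(p * (m + 1))) :=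
    fun r hr => by rw [hGdef, indicator_of_mem (show T r ∈ Ioi 0 from hTpos r hr), hn]
  set a := p * (m + 1) - 1 with ha
  have ha0 : 0 < a := by rw [ha]; nlinarith
  set s := (p - 1) / p with hs
  have hs0 : 0 < s := div_pos (by linarith) hp0
  have hconj : p.HolderConjugate (p / (p - 1)) := Real.HolderConjugate.conjExponent hp
  have hs1 : 1 / (p / (p - 1)) = s := by rw [hs, one_div_div]
  set D : ℝ → ℝ := fun r => s * (r ^ (a * s - 1) * T r ^ s *
    (a + r * (φ r ^ (p * (m + 1) / m) * r ^ ((p - 1) * (m + 1) - 1) /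
      (k * (T r ^ ((p - 1) * (m + 1) - 1) * (1 + T r) ^ (-(p * (m + 1)))))) / T r)) with hD
  have hφm' : Measurable φ := hφm.ennreal_toReal
  have hDm : Measurable D := by fun_prop
  have hDderiv : ∀ r ∈ I, HasDerivAt (fun r => r ^ (a * s) * T r ^ s) (D r) r := by
    intro r hr
    have h1 := hasDerivAt_rpow_mul_rpow a s (hI0 r hr) (hTpos r hr) (hT r hr)
    rw [hFI r hr, hGT r hr] at h1
    exact h1
  have hWmono : MonotoneOn (fun r => r ^ (a * s) * T r ^ s) I := by
    intro r hr r' hr' hrr'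
    have h1 := hI0 r hr
    have h1' := hI0 r' hr'
    have h2 := hTpos r hr
    have h3 := hmono.monotoneOn hr hr' hrr'
    simp only
    gcongr
  -- the pointwise inequality, integrated
  have step1 : ∫⁻ r in I, ENNReal.ofReal (F r) * ENNReal.ofReal (1 + T r) ≤
      ENNReal.ofReal (k ^ (1 / (p * (m + 1))) / ((p - 1) * (m + 1))) *
      ∫⁻ r in Ioi 0, tailIntegral μ ρ u r ^ ((p - 1) * (m + 1) / m + 1) *
        I.indicator (fun r => ENNReal.ofReal (D r)) r := by
    have hsub : I ⊆ Ioi 0 := hI0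
    have e : ∀ r, tailIntegral μ ρ u r ^ ((p - 1) * (m + 1) / m + 1) *
        I.indicator (fun r => ENNReal.ofReal (D r)) r =
        I.indicator (fun r => tailIntegral μ ρ u r ^ ((p - 1) * (m + 1) / m + 1) *
          ENNReal.ofReal (D r)) r := by
      intro r; by_cases hr : r ∈ I <;> simp [hr]
    simp_rw [e]
    rw [setLIntegral_indicator hIm, inter_eq_self_of_subset_left hsub,
      ← lintegral_const_mul' _ _ ENNReal.ofReal_ne_top]
    refine setLIntegral_mono' hIm fun r hr => ?_
    have h1 := hI0 r hr
    have h2 := hTpos r hr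
    have h3 := hIφ r hr
    have h4 : 0 ≤ k ^ (1 / (p * (m + 1))) / ((p - 1) * (m + 1)) :=
      div_nonneg (Real.rpow_nonneg hk.le _) hb.le
    rw [hφof, ENNReal.ofReal_rpow_of_pos h3, ← ENNReal.ofReal_mul (hF.nonneg r),
      ← ENNReal.ofReal_mul (Real.rpow_nonneg h3.le _), ← ENNReal.ofReal_mul h4]
    refine ENNReal.ofReal_le_ofReal ?_
    have := bliss_pointwise hp hm h3 h1 h2 hk
    rw [hFI r hr]
    calc _ = (1 + T r) * (φ r ^ (p * (m + 1) / m) * r ^ ((p - 1) * (m + 1) - 1)) := by ring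
      _ ≤ _ := this
      _ = _ := by
        rw [hD]
        simp only [hs, ha]
        have : p - 1 ≠ 0 := by linarith
        field_simp
  refine step1.trans (mul_le_mul' le_rfl ?_)
  -- Hölder's inequality after exchanging the order of integration
  have step2 := h.lintegral_tailIntegral_rpow_mul_le hu hfin
    (H := (p - 1) * (m + 1) / m + 1) (by have : 0 < (p - 1) * (m + 1) / m := by positivity
                                         linarith) hconj ((p - 1) * (m + Q))
    (w := I.indicator (fun r => ENNReal.ofReal (D r)))
    (W := I.indicator (fun r => ENNReal.ofReal (r ^ (a * s) * T r ^ s)))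
    ((by fun_prop : Measurable fun r => ENNReal.ofReal (D r)).indicator hIm)
    ((by fun_prop : Measurable fun r => ENNReal.ofReal (r ^ (a * s) * T r ^ s)).indicator hIm)
    (by
      intro t ht0 ht
      have htI : t ∈ I := by
        rw [hIdef]
        exact ⟨ht0, ENNReal.toReal_pos ht (tailIntegral_ne_top hfin t)⟩
      have hsub : Ioc 0 t ⊆ I := fun r hr => hF.mem_of_le t htI r hr.1 hr.2
      rw [indicator_of_mem htI, setLIntegral_indicator hIm, inter_eq_self_of_subset_right hsub]
      -- the integral of the derivative is the length of the image, as the function is monotone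
      have himg := lintegral_image_eq_lintegral_deriv_mul_of_monotoneOn measurableSet_Ioc
        (fun r hr => (hDderiv r (hsub hr)).hasDerivWithinAt) (hWmono.mono hsub) (fun _ => 1)
      simp only [mul_one, lintegral_one, Measure.restrict_apply MeasurableSet.univ,
        univ_inter] at himg
      rw [← himg]
      have hincl : (fun r => r ^ (a * s) * T r ^ s) '' Ioc 0 t ⊆ Ioc 0 (t ^ (a * s) * T t ^ s) := by
        rintro _ ⟨r, hr, rfl⟩
        have h1 := hI0 r (hsub hr)
        have h2 := hTpos r (hsub hr)
        exact ⟨by positivity, hWmono (hsub hr) htI hr.2⟩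
      refine (measure_mono hincl).trans ?_
      rw [Real.volume_Ioc, sub_zero])
  rw [hs1] at step2
  refine step2.trans (mul_le_mul' le_rfl (mul_le_mul' le_rfl (le_of_eq ?_)))
  congr 1
  have hext : ∀ f : ℝ → ℝ≥0∞, ∫⁻ r in I, f r = ∫⁻ r in Ioi 0, I.indicator f r := fun f => by
    rw [setLIntegral_indicator hIm, inter_eq_self_of_subset_left (show I ⊆ Ioi 0 from hI0)]
  rw [← lintegral_const_mul' _ _ ENNReal.ofReal_ne_top, hext]
  refine setLIntegral_congr_fun measurableSet_Ioi fun r _ => ?_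
  by_cases hr : r ∈ I
  · have h1 := hI0 r hr
    have h2 := hTpos r hr
    have h3 := hIφ r hr
    have hpp : 0 < p / (p - 1) := hconj.symm.pos
    simp only [indicator_of_mem hr]
    rw [hφof, ENNReal.ofReal_rpow_of_pos h3, ← ENNReal.ofReal_mul (hF.nonneg r),
      ← ENNReal.ofReal_mul (Real.rpow_nonneg h3.le _),
      ENNReal.ofReal_rpow_of_pos (by positivity), ← ENNReal.ofReal_mul (by positivity),
      ← ENNReal.ofReal_mul (by positivity), ← ENNReal.ofReal_mul (by positivity), hFI r hr]
    congr 1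
    have p1 : p - 1 ≠ 0 := by linarith
    have e1 : (φ r ^ ((p - 1) * (m + 1) / m + 1 - 1) * (r ^ (a * s) * T r ^ s)) ^ (p / (p - 1)) =
        φ r ^ (p * (m + 1) / m) * (r ^ a * T r) := by
      rw [Real.mul_rpow (by positivity) (by positivity), Real.mul_rpow (by positivity)
        (by positivity), ← Real.rpow_mul h3.le, ← Real.rpow_mul h1.le, ← Real.rpow_mul h2.le]
      have x1 : ((p - 1) * (m + 1) / m + 1 - 1) * (p / (p - 1)) = p * (m + 1) / m := by
        field_simp; ring
      have x2 : a * s * (p / (p - 1)) = a := by rw [hs]; field_simp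
      have x3 : s * (p / (p - 1)) = 1 := by rw [hs]; field_simp
      rw [x1, x2, x3, Real.rpow_one]
    have e2 : r ^ ((p - 1) * (m + 1) - 1) =
        r ^ (Q - 1) * r ^ a * r ^ (-((p - 1) * (m + Q) / p * (p / (p - 1)))) := by
      rw [← Real.rpow_add h1, ← Real.rpow_add h1]
      congr 1
      rw [ha]; field_simp; ring
    rw [e1, e2]
    ring
  · simp only [indicator_of_notMem hr]
    rw [mul_zero, ENNReal.zero_rpow_of_pos hconj.symm.pos]; simp

end

section
variable {X : Type*} [MeasurableSpace X] {μ : Measure X} {ρ : X → ℝ} {V Q : ℝ} {u : X → ℝ≥0∞}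

/-- Bliss's inequality for integrable functions that vanish outside a ball. -/
theorem PowerGrowth.bliss_of_truncated (h : PowerGrowth μ ρ V Q) (hu : Measurable u)
    (hfin : ∫⁻ x, u x ∂μ ≠ ⊤) {R : ℝ} (hR : ∀ x, R ≤ ρ x → u x = 0)
    {p m : ℝ} (hp : 1 < p) (hm : 0 < m)
    (hE : weightedEnergy μ ρ p ((p - 1) * (m + Q)) u ≠ ⊤) :
    tailEnergy μ ρ (p * (m + 1) / m) ((p - 1) * (m + 1) - Q) u ^ (1 / (p * (m + 1) / m)) ≤
      ENNReal.ofReal (blissConst (Q * V) p m) *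
        weightedEnergy μ ρ p ((p - 1) * (m + Q)) u ^ (1 / p) := by
  have hp0 : 0 < p := by linarith
  have hb : 0 < (p - 1) * (m + 1) := mul_pos (by linarith) (by linarith)
  have hm1 : 0 < m + 1 := by linarith
  have hQ := h.dim_pos
  have hV := h.const_pos
  have hq : 0 < p * (m + 1) / m := by positivity
  have hF := h.isInitialDensity_tail hu hfin hR hq hb
  have hG := isInitialDensity_beta hb hm1
  set I := {r | 0 < r ∧ 0 < (tailIntegral μ ρ u r).toReal} with hI
  set F := (Ioi 0).indicator fun r =>
      (tailIntegral μ ρ u r).toReal ^ (p * (m + 1) / m) * r ^ ((p - 1) * (m + 1) - 1) with hFdef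
  set G := (Ioi 0).indicator fun y : ℝ =>
      y ^ ((p - 1) * (m + 1) - 1) * (1 + y) ^ (-((p - 1) * (m + 1) + (m + 1))) with hGdef
  have hGint : ∀ (w : ℝ → ℝ), ∫⁻ y in Ioi 0, ENNReal.ofReal (G y) * ENNReal.ofReal (w y) =
      ∫⁻ y in Ioi 0, ENNReal.ofReal (y ^ ((p - 1) * (m + 1) - 1) *
        (1 + y) ^ (-((p - 1) * (m + 1) + (m + 1))) * w y) := by
    intro w
    refine setLIntegral_congr_fun measurableSet_Ioi fun y hy => ?_
    have hy' : 0 < y := hy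
    rw [← ENNReal.ofReal_mul (hG.nonneg y), hGdef, indicator_of_mem hy]
  have hB0 : ∫⁻ y in Ioi 0, ENNReal.ofReal (G y) =
      ENNReal.ofReal (ProbabilityTheory.beta ((p - 1) * (m + 1)) (m + 1)) := by
    rw [← lintegral_rpow_mul_one_add_rpow hb hm1]
    refine setLIntegral_congr_fun measurableSet_Ioi fun y hy => ?_
    rw [hGdef, indicator_of_mem hy]
  have hB1 : ∫⁻ y in Ioi 0, ENNReal.ofReal (G y) * ENNReal.ofReal (1 + y) =
      ENNReal.ofReal (ProbabilityTheory.beta ((p - 1) * (m + 1)) m) := by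
    rw [hGint, ← lintegral_rpow_mul_one_add_rpow hb hm]
    refine setLIntegral_congr_fun measurableSet_Ioi fun y hy => ?_
    have hy' : 0 < y := hy
    have hy1 : 0 < 1 + y := by linarith
    rw [mul_assoc, ← Real.rpow_add_one hy1.ne']
    congr 3; ring
  have hB2 : ∫⁻ y in Ioi 0, ENNReal.ofReal (G y) * ENNReal.ofReal y =
      ENNReal.ofReal (ProbabilityTheory.beta ((p - 1) * (m + 1) + 1) m) := by
    rw [hGint (fun y => y), ← lintegral_rpow_mul_one_add_rpow (by linarith) hm]
    refine setLIntegral_congr_fun measurableSet_Ioi fun y hy => ?_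
    have hy' : 0 < y := hy
    rw [mul_right_comm, ← Real.rpow_add_one hy'.ne']
    congr 3 <;> ring
  have hBpos := ProbabilityTheory.beta_pos hb hm1
  have hBpos1 := ProbabilityTheory.beta_pos hb hm
  have hBpos2 := ProbabilityTheory.beta_pos (show 0 < (p - 1) * (m + 1) + 1 by linarith) hm
  have hTE : tailEnergy μ ρ (p * (m + 1) / m) ((p - 1) * (m + 1) - Q) u =
      ENNReal.ofReal (Q * V) * ∫⁻ r in Ioi 0, ENNReal.ofReal (F r) := by
    rw [h.tailEnergy_eq]
    congr 1
    refine setLIntegral_congr_fun measurableSet_Ioi fun r hr => ?_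
    have hr' : 0 < r := hr
    rw [hFdef, indicator_of_mem hr, ENNReal.ofReal_mul (by positivity),
      ← ENNReal.ofReal_rpow_of_nonneg ENNReal.toReal_nonneg hq.le,
      ENNReal.ofReal_toReal (tailIntegral_ne_top hfin r), sub_add_cancel]
  have hFint : ∫⁻ r in Ioi 0, ENNReal.ofReal (F r) = ENNReal.ofReal (∫ r in Ioi 0, F r) :=
    (ofReal_integral_eq_lintegral_ofReal hF.integrable.integrableOn
      (Eventually.of_forall hF.nonneg)).symm
  have hGint' : ∫ y in Ioi 0, G y = ProbabilityTheory.beta ((p - 1) * (m + 1)) (m + 1) := by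
    rw [integral_eq_lintegral_of_nonneg_ae (Eventually.of_forall hG.nonneg)
      hG.integrable.integrableOn.aestronglyMeasurable, hB0, ENNReal.toReal_ofReal hBpos.le]
  rw [hTE, hFint]
  -- there is nothing to transport if all tails vanish
  rcases I.eq_empty_or_nonempty with hIe | ⟨r₀, hr₀⟩
  · have : ∫ r in Ioi 0, F r = 0 := by
      have h0 : F = fun _ => 0 := funext fun r => hF.eq_zero r (by rw [hIe]; exact notMem_empty r)
      rw [h0]; simp
    rw [this, ENNReal.ofReal_zero, mul_zero, ENNReal.zero_rpow_of_pos (by positivity)]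
    exact zero_le
  have hJpos : 0 < ∫ r in Ioi 0, F r := (hF.primitive_pos hr₀).trans (hF.primitive_lt hr₀)
  set k := (∫ r in Ioi 0, F r) / ProbabilityTheory.beta ((p - 1) * (m + 1)) (m + 1) with hkdef
  have hk : 0 < k := div_pos hJpos hBpos
  have hJk : ∫ r in Ioi 0, F r = k * ProbabilityTheory.beta ((p - 1) * (m + 1)) (m + 1) := by
    rw [hkdef]; field_simp
  obtain ⟨T, hTm, hTJ, hT, hmono, himage⟩ := hF.exists_transport hG hk (by rw [hGint', hJk])
  have htr := hF.lintegral_transport hG hk hTJ hT hmono himage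
  have main := h.tail_integral_transport_le hu hfin hp hm hk hFdef hGdef hI hF hTm hTJ hT hmono
  rw [htr (fun y => ENNReal.ofReal (1 + y)), htr (fun y => ENNReal.ofReal y), hB1, hB2,
    ← ENNReal.ofReal_mul hk.le, ← ENNReal.ofReal_mul hk.le,
    ← ENNReal.ofReal_mul (by positivity : 0 ≤ Q * V),
    ENNReal.ofReal_rpow_of_pos (by positivity)] at main
  have hE' : weightedEnergy μ ρ p ((p - 1) * (m + Q)) u ^ (1 / p) ≠ ⊤ :=
    ENNReal.rpow_ne_top_of_nonneg (by positivity) hE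
  rw [← ENNReal.ofReal_toReal hE'] at main ⊢
  set e := (weightedEnergy μ ρ p ((p - 1) * (m + Q)) u ^ (1 / p)).toReal with he
  have he0 : 0 ≤ e := ENNReal.toReal_nonneg
  have h4 : 0 ≤ k ^ (1 / (p * (m + 1))) / ((p - 1) * (m + 1)) :=
      div_nonneg (Real.rpow_nonneg hk.le _) hb.le
  have h5 : 0 ≤ (p - 1) * (m + 1) / m + 1 := by
    have := div_pos hb hm; linarith
  rw [← ENNReal.ofReal_mul he0, ← ENNReal.ofReal_mul h5, ← ENNReal.ofReal_mul h4,
    ENNReal.ofReal_le_ofReal_iff (by positivity)] at main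
  have fin := rpow_le_blissConst_mul (by positivity : 0 < Q * V) hp hm hk main
  rw [hJk, ← ENNReal.ofReal_mul (by positivity), ENNReal.ofReal_rpow_of_nonneg (by positivity)
    (by positivity), ← ENNReal.ofReal_mul (blissConst_pos (by positivity) hp hm).le, one_div_div]
  exact ENNReal.ofReal_le_ofReal fin

/-- A function of finite energy is integrable on annuli. -/
theorem PowerGrowth.lintegral_annulus_ne_top (h : PowerGrowth μ ρ V Q)
    {p α : ℝ} (hp : 1 ≤ p) (hE : weightedEnergy μ ρ p α u ≠ ⊤) {a b : ℝ} (ha : 0 < a) :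
    ∫⁻ x in {x | a ≤ ρ x ∧ ρ x < b}, u x ∂μ ≠ ⊤ := by
  have hset : MeasurableSet {x | a ≤ ρ x ∧ ρ x < b} :=
    (measurableSet_le measurable_const h.measurable).inter
      (measurableSet_lt h.measurable measurable_const)
  by_cases hab : a ≤ b
  swap
  · have : {x | a ≤ ρ x ∧ ρ x < b} = ∅ := by
      ext x; simp only [mem_ofPred_eq, mem_empty_iff_false, iff_false, not_and, not_lt]
      intro h1; linarith [not_le.1 hab]
    rw [this]; simp
  set c := min (a ^ α) (b ^ α) with hc
  have hb : 0 < b := ha.trans_le hab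
  have hc0 : 0 < c := lt_min (by positivity) (by positivity)
  have hbound : ∀ x ∈ {x | a ≤ ρ x ∧ ρ x < b}, u x ≤
      1 + ENNReal.ofReal c⁻¹ * (u x ^ p * ENNReal.ofReal (ρ x ^ α)) := by
    intro x hx
    have hxa : a ≤ ρ x := hx.1
    have hxb : ρ x < b := hx.2
    rcases le_total (u x) 1 with h1 | h1
    · exact h1.trans le_self_add
    · have hcx : c ≤ ρ x ^ α := by
        rcases le_total 0 α with hα | hα
        · exact (min_le_left _ _).trans (Real.rpow_le_rpow ha.le hxa hα)
        · exact (min_le_right _ _).trans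
            (Real.rpow_le_rpow_of_nonpos (ha.trans_le hxa) hxb.le hα)
      have h2 : u x ≤ u x ^ p := by
        conv_lhs => rw [← ENNReal.rpow_one (u x)]
        exact ENNReal.rpow_le_rpow_of_exponent_le h1 hp
      have h3 : (1 : ℝ≥0∞) ≤ ENNReal.ofReal c⁻¹ * ENNReal.ofReal (ρ x ^ α) := by
        rw [← ENNReal.ofReal_mul (by positivity), ENNReal.one_le_ofReal, inv_mul_eq_div,
          le_div_iff₀ hc0, one_mul]
        exact hcx
      calc u x ≤ u x ^ p * 1 := by rw [mul_one]; exact h2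
        _ ≤ u x ^ p * (ENNReal.ofReal c⁻¹ * ENNReal.ofReal (ρ x ^ α)) := by gcongr
        _ = ENNReal.ofReal c⁻¹ * (u x ^ p * ENNReal.ofReal (ρ x ^ α)) := by ring
        _ ≤ _ := le_add_self
  have hρ := h.measurable
  refine ne_top_of_le_ne_top ?_ (setLIntegral_mono' hset hbound)
  rw [lintegral_add_left measurable_const, lintegral_const_mul' _ _ ENNReal.ofReal_ne_top]
  refine ENNReal.add_ne_top.2 ⟨?_, ENNReal.mul_ne_top ENNReal.ofReal_ne_top
    (ne_top_of_le_ne_top hE (setLIntegral_le_lintegral _ _))⟩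
  rw [setLIntegral_const, one_mul, h.measure_Ico ha.le hab]
  exact ENNReal.ofReal_ne_top

theorem weightedEnergy_mono {p α : ℝ} (hp : 0 ≤ p) {u w : X → ℝ≥0∞} (huw : u ≤ w) :
    weightedEnergy μ ρ p α u ≤ weightedEnergy μ ρ p α w :=
  lintegral_mono fun x => mul_le_mul' (ENNReal.rpow_le_rpow (huw x) hp) le_rfl

/-- By monotone convergence, the inequality need only be tested on integrable functions supported in
annuli. -/
theorem PowerGrowth.tailInequality_of_truncated (h : PowerGrowth μ ρ V Q) {p q α β : ℝ}
    (hp : 1 ≤ p) (hq : 0 < q) {K : ℝ≥0∞}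
    (H : ∀ u : X → ℝ≥0∞, Measurable u → ∫⁻ x, u x ∂μ ≠ ⊤ →
      (∃ a R : ℝ, 0 < a ∧ ∀ x, (ρ x < a ∨ R ≤ ρ x) → u x = 0) → weightedEnergy μ ρ p α u ≠ ⊤ →
      tailEnergy μ ρ q β u ^ (1 / q) ≤ K * weightedEnergy μ ρ p α u ^ (1 / p)) :
    TailInequality μ ρ p q α β K := by
  intro u hu hE
  have hρ := h.measurable
  set S : ℕ → Set X := fun n => {x | ((n : ℝ) + 1)⁻¹ ≤ ρ x ∧ ρ x < n + 1} with hS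
  have hSm : ∀ n, MeasurableSet (S n) := fun n =>
    (measurableSet_le measurable_const h.measurable).inter
      (measurableSet_lt h.measurable measurable_const)
  have hSmono : Monotone S := by
    intro n k hnk x hx
    have hnk' : (n : ℝ) ≤ k := by exact_mod_cast hnk
    refine ⟨le_trans ?_ hx.1, hx.2.trans_le (by linarith)⟩
    gcongr
  have hSall : ∀ x, 0 < ρ x → ∀ᶠ n in atTop, x ∈ S n := by
    intro x hx
    obtain ⟨n₁, hn₁⟩ := exists_nat_gt (ρ x)
    obtain ⟨n₂, hn₂⟩ := exists_nat_gt (ρ x)⁻¹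
    filter_upwards [eventually_ge_atTop n₁, eventually_ge_atTop n₂] with n h1 h2
    have h1' : (n₁ : ℝ) ≤ n := by exact_mod_cast h1
    have h2' : (n₂ : ℝ) ≤ n := by exact_mod_cast h2
    refine ⟨?_, by linarith⟩
    rw [inv_le_comm₀ (by positivity) hx]
    linarith
  set w : ℕ → X → ℝ≥0∞ := fun n => (S n).indicator u with hw
  have hwm : ∀ n, Measurable (w n) := fun n => hu.indicator (hSm n)
  have hwmono : Monotone w := fun n k hnk =>
    indicator_le_indicator_of_subset (hSmono hnk) (fun _ => zero_le)
  have hwu : ∀ n, w n ≤ u := fun n => indicator_le_self' fun _ _ => zero_le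
  have hwsup : ∀ᵐ x ∂μ, ⨆ n, w n x = u x := by
    filter_upwards [h.ae_pos] with x hx
    refine le_antisymm (iSup_le fun n => hwu n x) ?_
    obtain ⟨n, hn⟩ := (hSall x hx).exists
    refine le_iSup_of_le n ?_
    simp only [hw, indicator_of_mem hn, le_refl]
  have hbd : ∀ n, tailEnergy μ ρ q β (w n) ≤ (K * weightedEnergy μ ρ p α u ^ (1 / p)) ^ q := by
    intro n
    have hpos : 0 < (n : ℝ) + 1 := by positivity
    have hEn : weightedEnergy μ ρ p α (w n) ≤ weightedEnergy μ ρ p α u :=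
      weightedEnergy_mono (by linarith) (hwu n)
    have := H (w n) (hwm n) (by
      rw [hw]; simp only
      rw [lintegral_indicator (hSm n)]
      exact h.lintegral_annulus_ne_top hp hE (inv_pos.2 hpos))
      ⟨((n : ℝ) + 1)⁻¹, n + 1, inv_pos.2 hpos, fun x hx => indicator_of_notMem (by
        rintro ⟨h1, h2⟩
        rcases hx with hx | hx <;> linarith) _⟩ (ne_top_of_le_ne_top hE hEn)
    rw [one_div, ENNReal.rpow_inv_le_iff hq] at this
    refine this.trans ?_
    gcongr
  -- monotone convergence, first for the tails and then for their weighted powers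
  have htail : ∀ r, tailIntegral μ ρ u r = ⨆ n, tailIntegral μ ρ (w n) r := by
    intro r
    unfold tailIntegral
    rw [← lintegral_iSup hwm hwmono]
    exact lintegral_congr_ae (ae_restrict_of_ae (hwsup.mono fun x hx => hx.symm))
  have hTE : tailEnergy μ ρ q β u = ⨆ n, tailEnergy μ ρ q β (w n) := by
    unfold tailEnergy
    rw [← lintegral_iSup]
    · refine lintegral_congr fun x => ?_
      rw [htail, ← ENNReal.iSup_mul]
      congr 1
      exact (ENNReal.orderIsoRpow q hq).map_iSup _
    · intro n
      have := measurable_tailIntegral μ ρ (w n)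
      fun_prop
    · intro n k hnk x
      exact mul_le_mul' (ENNReal.rpow_le_rpow (lintegral_mono (hwmono hnk)) hq.le) le_rfl
  rw [one_div, ENNReal.rpow_inv_le_iff hq, hTE]
  exact iSup_le hbd

/-- Bliss's inequality with its sharp constant. The gauge is normalised so that the extremal tail is
`(1 + r) ^ (-m)`; `PowerGrowth.tailInequality_iff_rpow` reduces the general exponents to these. -/
theorem PowerGrowth.bliss (h : PowerGrowth μ ρ V Q) {p m : ℝ} (hp : 1 < p) (hm : 0 < m) :
    TailInequality μ ρ p (p * (m + 1) / m) ((p - 1) * (m + Q)) ((p - 1) * (m + 1) - Q)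
      (ENNReal.ofReal (blissConst (Q * V) p m)) := by
  refine h.tailInequality_of_truncated hp.le (by positivity) fun u hu hfin hsupp hE => ?_
  obtain ⟨_, R, _, hR⟩ := hsupp
  exact h.bliss_of_truncated hu hfin (fun x hx => hR x (Or.inr hx)) hp hm hE

end

/-! ### Optimality, and Hardy's inequality -/

section
variable {X : Type*} [MeasurableSpace X] {μ : Measure X} {ρ : X → ℝ} {V Q : ℝ} {u : X → ℝ≥0∞}

theorem PowerGrowth.tailIntegral_comp (h : PowerGrowth μ ρ V Q) {f : ℝ → ℝ≥0∞}
    (hf : Measurable f) {r : ℝ} (hr : 0 < r) :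
    tailIntegral μ ρ (fun x => f (ρ x)) r =
      ∫⁻ s in Ioi r, ENNReal.ofReal (Q * V * s ^ (Q - 1)) * f s := by
  unfold tailIntegral
  rw [← lintegral_indicator (measurableSet_le measurable_const h.measurable)]
  have e : ∀ x, {y | r ≤ ρ y}.indicator (fun x => f (ρ x)) x = (Ici r).indicator f (ρ x) := by
    intro x
    by_cases hx : r ≤ ρ x
    · rw [indicator_of_mem (show x ∈ {y | r ≤ ρ y} from hx),
        indicator_of_mem (show ρ x ∈ Ici r from hx)]
    · rw [indicator_of_notMem (show x ∉ {y | r ≤ ρ y} from hx),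
        indicator_of_notMem (show ρ x ∉ Ici r from hx)]
  simp_rw [e]
  rw [h.lintegral_comp (hf.indicator measurableSet_Ici)]
  have e2 : ∀ s, ENNReal.ofReal (Q * V * s ^ (Q - 1)) * (Ici r).indicator f s =
      (Ici r).indicator (fun s => ENNReal.ofReal (Q * V * s ^ (Q - 1)) * f s) s := by
    intro s; by_cases hs : s ∈ Ici r <;> simp [hs]
  simp_rw [e2]
  rw [setLIntegral_indicator measurableSet_Ici,
    inter_eq_self_of_subset_left (show Ici r ⊆ Ioi 0 from fun s hs => hr.trans_le hs),
    setLIntegral_congr Ioi_ae_eq_Ici.symm]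

theorem PowerGrowth.weightedEnergy_comp (h : PowerGrowth μ ρ V Q) {f : ℝ → ℝ≥0∞}
    (hf : Measurable f) (p α : ℝ) :
    weightedEnergy μ ρ p α (fun x => f (ρ x)) = ENNReal.ofReal (Q * V) *
      ∫⁻ r in Ioi 0, f r ^ p * ENNReal.ofReal (r ^ (α + Q - 1)) := by
  have hV := h.const_pos
  have hQ := h.dim_pos
  unfold weightedEnergy
  rw [h.lintegral_comp (f := fun r => f r ^ p * ENNReal.ofReal (r ^ α))
    (by fun_prop), ← lintegral_const_mul' _ _ ENNReal.ofReal_ne_top]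
  refine setLIntegral_congr_fun measurableSet_Ioi fun r hr => ?_
  have hr : 0 < r := hr
  rw [show α + Q - 1 = (Q - 1) + α by ring, Real.rpow_add hr, ENNReal.ofReal_mul (by positivity),
    ENNReal.ofReal_mul (p := r ^ (Q - 1)) (by positivity)]
  ring

theorem lintegral_Ioi_one_add_rpow {m r : ℝ} (hm : 0 < m) (hr : 0 ≤ r) :
    ∫⁻ s in Ioi r, ENNReal.ofReal (m * (1 + s) ^ (-(m + 1))) =
      ENNReal.ofReal ((1 + r) ^ (-m)) := by
  have hder : ∀ s ∈ Ici r,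
      HasDerivAt (fun s : ℝ => -(1 + s) ^ (-m)) (m * (1 + s) ^ (-(m + 1))) s := by
    intro s hs
    have hs0 : 0 < 1 + s := by have : r ≤ s := hs; linarith
    have h1 : HasDerivAt (fun s : ℝ => 1 + s) 1 s := (hasDerivAt_id s).const_add 1
    have h2 := (h1.rpow_const (p := -m) (Or.inl hs0.ne')).neg
    have e : m * (1 + s) ^ (-(m + 1)) = -(1 * -m * (1 + s) ^ (-m - 1)) := by
      rw [show -m - 1 = -(m + 1) by ring]; ring
    rw [e]; exact h2
  have hpos : ∀ s ∈ Ioi r, 0 ≤ m * (1 + s) ^ (-(m + 1)) := by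
    intro s hs
    have hs0 : 0 < 1 + s := by have : r < s := hs; linarith
    positivity
  have hlim : Tendsto (fun s : ℝ => -(1 + s) ^ (-m)) atTop (𝓝 (-0)) :=
    ((tendsto_rpow_neg_atTop hm).comp (tendsto_atTop_add_const_left _ 1 tendsto_id)).neg
  rw [← ofReal_integral_eq_lintegral_ofReal
    (integrableOn_Ioi_deriv_of_nonneg' hder hpos hlim)
    ((ae_restrict_mem measurableSet_Ioi).mono hpos),
    integral_Ioi_of_hasDerivAt_of_nonneg' hder hpos hlim]
  simp

/-- The constant in `PowerGrowth.bliss` is attained, at the function of the gauge whose tail is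
`(1 + r) ^ (-m)`. -/
theorem PowerGrowth.blissConst_le (h : PowerGrowth μ ρ V Q) {p m : ℝ} (hp : 1 < p) (hm : 0 < m)
    {K : ℝ≥0∞} (hK : TailInequality μ ρ p (p * (m + 1) / m) ((p - 1) * (m + Q))
      ((p - 1) * (m + 1) - Q) K) :
    ENNReal.ofReal (blissConst (Q * V) p m) ≤ K := by
  have hp0 : 0 < p := by linarith
  have hb : 0 < (p - 1) * (m + 1) := mul_pos (by linarith) (by linarith)
  have hm1 : 0 < m + 1 := by linarith
  have hV := h.const_pos
  have hQ := h.dim_pos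
  have hA : 0 < Q * V := by positivity
  have hq : 0 < p * (m + 1) / m := by positivity
  have hB0 := ProbabilityTheory.beta_pos hb hm1
  have hB2 := ProbabilityTheory.beta_pos (show 0 < (p - 1) * (m + 1) + 1 by linarith) hm
  set f : ℝ → ℝ≥0∞ := fun r =>
    ENNReal.ofReal (m * (1 + r) ^ (-(m + 1)) / (Q * V * r ^ (Q - 1))) with hf
  have hfm : Measurable f := by fun_prop
  have htail : ∀ r, 0 < r → tailIntegral μ ρ (fun x => f (ρ x)) r =
      ENNReal.ofReal ((1 + r) ^ (-m)) := by
    intro r hr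
    rw [h.tailIntegral_comp hfm hr, ← lintegral_Ioi_one_add_rpow hm hr.le]
    refine setLIntegral_congr_fun measurableSet_Ioi fun s hs => ?_
    have hs0 : 0 < s := hr.trans hs
    rw [hf, ← ENNReal.ofReal_mul (by positivity)]
    congr 1; field_simp
  have hTE : tailEnergy μ ρ (p * (m + 1) / m) ((p - 1) * (m + 1) - Q) (fun x => f (ρ x)) =
      ENNReal.ofReal (Q * V * ProbabilityTheory.beta ((p - 1) * (m + 1)) (m + 1)) := by
    rw [h.tailEnergy_eq, ENNReal.ofReal_mul hA.le, ← lintegral_rpow_mul_one_add_rpow hb hm1]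
    congr 1
    refine setLIntegral_congr_fun measurableSet_Ioi fun r hr => ?_
    have hr0 : 0 < r := hr
    rw [htail r hr0, ENNReal.ofReal_rpow_of_pos (by positivity), ← ENNReal.ofReal_mul
      (by positivity), ← Real.rpow_mul (by positivity), sub_add_cancel, mul_comm]
    congr 3
    field_simp; ring
  have hE : weightedEnergy μ ρ p ((p - 1) * (m + Q)) (fun x => f (ρ x)) =
      ENNReal.ofReal ((Q * V) ^ (1 - p) * m ^ p *
        ProbabilityTheory.beta ((p - 1) * (m + 1) + 1) m) := by
    rw [h.weightedEnergy_comp hfm, ENNReal.ofReal_mul (p := (Q * V) ^ (1 - p) * m ^ p)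
        (by positivity),
      ← lintegral_rpow_mul_one_add_rpow (by linarith) hm,
      ← lintegral_const_mul' _ _ ENNReal.ofReal_ne_top,
      ← lintegral_const_mul' _ _ ENNReal.ofReal_ne_top]
    refine setLIntegral_congr_fun measurableSet_Ioi fun r hr => ?_
    have hr0 : 0 < r := hr
    have hr1 : 0 < 1 + r := by linarith
    simp only [hf]
    rw [ENNReal.ofReal_rpow_of_pos (by positivity), ← ENNReal.ofReal_mul (by positivity),
      ← ENNReal.ofReal_mul (by positivity), ← ENNReal.ofReal_mul (by positivity)]
    congr 1
    rw [Real.div_rpow (by positivity) (by positivity), Real.mul_rpow hm.le (by positivity),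
      Real.mul_rpow hA.le (by positivity), ← Real.rpow_mul hr1.le, ← Real.rpow_mul hr0.le,
      Real.rpow_sub hA, Real.rpow_one]
    have e1 : r ^ ((p - 1) * (m + Q) + Q - 1) =
        r ^ ((p - 1) * (m + 1) + 1 - 1) * r ^ ((Q - 1) * p) := by
      rw [← Real.rpow_add hr0]; congr 1; ring
    have e2 : -(m + 1) * p = -((p - 1) * (m + 1) + 1 + m) := by ring
    rw [e1, e2]
    field_simp
  have key := hK (fun x => f (ρ x)) (hfm.comp h.measurable)
    (by rw [hE]; exact ENNReal.ofReal_ne_top)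
  rw [hTE, hE, ENNReal.ofReal_rpow_of_pos (by positivity),
    ENNReal.ofReal_rpow_of_pos (by positivity)] at key
  have hE1 : ((Q * V) ^ (1 - p) * m ^ p *
        ProbabilityTheory.beta ((p - 1) * (m + 1) + 1) m) ^ (1 / p) =
      (Q * V) ^ (-((p - 1) / p)) * m *
        ProbabilityTheory.beta ((p - 1) * (m + 1) + 1) m ^ (1 / p) := by
    rw [Real.mul_rpow (by positivity) hB2.le, Real.mul_rpow (by positivity) (by positivity),
      ← Real.rpow_mul hA.le, ← Real.rpow_mul hm.le, mul_one_div_cancel hp0.ne', Real.rpow_one]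
    congr 3; field_simp; ring
  have hconst : (Q * V * ProbabilityTheory.beta ((p - 1) * (m + 1)) (m + 1)) ^
        (1 / (p * (m + 1) / m)) = blissConst (Q * V) p m * ((Q * V) ^ (-((p - 1) / p)) * m *
        ProbabilityTheory.beta ((p - 1) * (m + 1) + 1) m ^ (1 / p)) := by
    unfold blissConst
    rw [one_div_div, Real.mul_rpow hA.le hB0.le, Real.rpow_add hA, Real.rpow_neg hA.le,
      Real.rpow_neg hB2.le]
    have := (Real.rpow_pos_of_pos hB2 (1 / p)).ne'
    generalize ProbabilityTheory.beta ((p - 1) * (m + 1) + 1) m ^ (1 / p) = y at *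
    field_simp
  rw [hE1, hconst, ENNReal.ofReal_mul (blissConst_pos hA hp hm).le] at key
  exact (ENNReal.mul_le_mul_iff_left (by
    rw [ne_eq, ENNReal.ofReal_eq_zero, not_le]; positivity) ENNReal.ofReal_ne_top).1 key

/-- Hardy's inequality, the case `p = q`. This is the argument of the case `p < q` with the identity
for the transport map. -/
theorem PowerGrowth.hardy (h : PowerGrowth μ ρ V Q) {p α : ℝ} (hp : 1 < p)
    (hα : Q * (p - 1) < α) :
    TailInequality μ ρ p p α (α - p * Q)
      (ENNReal.ofReal (p * (Q * V) / (α - Q * (p - 1)))) := by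
  have hp0 : 0 < p := by linarith
  refine h.tailInequality_of_truncated hp.le hp0 fun u hu hfin hsupp hE => ?_
  obtain ⟨_, R, _, hR⟩ := hsupp
  have hV := h.const_pos
  have hQ := h.dim_pos
  have hA : 0 < Q * V := by positivity
  set b := α - Q * (p - 1) with hb
  have hb0 : 0 < b := by rw [hb]; linarith
  set s := (p - 1) / p with hs
  have hs0 : 0 < s := div_pos (by linarith) hp0
  have hconj : p.HolderConjugate (p / (p - 1)) := Real.HolderConjugate.conjExponent hp
  have hs1 : 1 / (p / (p - 1)) = s := by rw [hs, one_div_div]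
  have hF := h.isInitialDensity_tail hu hfin (fun x hx => hR x (Or.inr hx)) hp0 hb0
  set J := ∫⁻ r in Ioi 0, tailIntegral μ ρ u r ^ p * ENNReal.ofReal (r ^ (b - 1)) with hJ
  have hJtop : J ≠ ⊤ := by
    have e : J = ∫⁻ r in Ioi 0, ENNReal.ofReal ((Ioi 0).indicator (fun r =>
        (tailIntegral μ ρ u r).toReal ^ p * r ^ (b - 1)) r) := by
      refine setLIntegral_congr_fun measurableSet_Ioi fun r hr => ?_
      have hr' : 0 < r := hr
      rw [indicator_of_mem hr, ENNReal.ofReal_mul (by positivity),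
        ← ENNReal.ofReal_rpow_of_nonneg ENNReal.toReal_nonneg hp0.le,
        ENNReal.ofReal_toReal (tailIntegral_ne_top hfin r)]
    rw [e, ← ofReal_integral_eq_lintegral_ofReal hF.integrable.integrableOn
      (Eventually.of_forall hF.nonneg)]
    exact ENNReal.ofReal_ne_top
  have hTE : tailEnergy μ ρ p (α - p * Q) u = ENNReal.ofReal (Q * V) * J := by
    rw [h.tailEnergy_eq, show α - p * Q + Q - 1 = b - 1 by rw [hb]; ring]
  have main := h.lintegral_tailIntegral_rpow_mul_le hu hfin hp hconj α
    (w := fun r => ENNReal.ofReal (r ^ (b - 1))) (W := fun r => ENNReal.ofReal (r ^ b / b))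
    (by fun_prop) (by fun_prop) (by
      intro t ht _
      rw [← ofReal_integral_eq_lintegral_ofReal, ← intervalIntegral.integral_of_le ht.le,
        integral_rpow (Or.inl (by linarith)), sub_add_cancel, Real.zero_rpow hb0.ne', sub_zero]
      · rw [← IntegrableOn, ← intervalIntegrable_iff_integrableOn_Ioc_of_le ht.le]
        exact intervalIntegral.intervalIntegrable_rpow' (by linarith)
      · filter_upwards [self_mem_ae_restrict measurableSet_Ioc] with x hx
        have : 0 < x := hx.1
        positivity)
  have hsec : ∫⁻ r in Ioi 0, ENNReal.ofReal (Q * V * r ^ (Q - 1)) *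
        ((tailIntegral μ ρ u r ^ (p - 1) * ENNReal.ofReal (r ^ b / b)) ^ (p / (p - 1)) *
          ENNReal.ofReal (r ^ (-(α / p * (p / (p - 1)))))) =
      ENNReal.ofReal (Q * V * (b ^ (p / (p - 1)))⁻¹) * J := by
    rw [hJ, ← lintegral_const_mul' _ _ ENNReal.ofReal_ne_top]
    refine setLIntegral_congr_fun measurableSet_Ioi fun r hr => ?_
    have hr0 : 0 < r := hr
    have p1 : p - 1 ≠ 0 := by linarith
    rw [ENNReal.mul_rpow_of_nonneg _ _ hconj.symm.nonneg, ← ENNReal.rpow_mul,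
      mul_div_cancel₀ _ p1, ENNReal.ofReal_rpow_of_pos (by positivity),
      Real.div_rpow (by positivity) hb0.le, ← Real.rpow_mul hr0.le]
    have e : r ^ (b - 1) = r ^ (Q - 1) * r ^ (b * (p / (p - 1))) *
        r ^ (-(α / p * (p / (p - 1)))) := by
      rw [← Real.rpow_add hr0, ← Real.rpow_add hr0]; congr 1; rw [hb]; field_simp; ring
    rw [e, mul_assoc (tailIntegral μ ρ u r ^ p), mul_left_comm,
      mul_left_comm _ (tailIntegral μ ρ u r ^ p), ← ENNReal.ofReal_mul (by positivity),
      ← ENNReal.ofReal_mul (by positivity), ← ENNReal.ofReal_mul (by positivity)]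
    congr 2
    ring
  rw [hsec, hs1, ENNReal.mul_rpow_of_nonneg _ _ hs0.le,
    ENNReal.ofReal_rpow_of_pos (by positivity)] at main
  have hreal : (Q * V * (b ^ (p / (p - 1)))⁻¹) ^ s = (Q * V) ^ s / b := by
    rw [Real.mul_rpow hA.le (by positivity), Real.inv_rpow (by positivity), ← Real.rpow_mul hb0.le]
    have : p / (p - 1) * s = 1 := by
      have p1 : p - 1 ≠ 0 := by linarith
      rw [hs]; field_simp
    rw [this, Real.rpow_one]; rfl
  rw [hreal] at main
  have hmain : J ≤ ENNReal.ofReal (p * (Q * V) ^ s / b) *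
      weightedEnergy μ ρ p α u ^ (1 / p) * J ^ s := by
    refine main.trans (le_of_eq ?_)
    rw [mul_div_assoc, ENNReal.ofReal_mul hp0.le]; ring
  rw [hTE, ENNReal.mul_rpow_of_nonneg _ _ (by positivity)]
  rcases eq_or_ne J 0 with hJ0 | hJ0
  · rw [hJ0, ENNReal.zero_rpow_of_pos (by positivity), mul_zero]; exact zero_le
  -- absorb the tails on the right; their integral is finite because `u` is truncated
  have hsplit : J = J ^ (1 / p) * J ^ s := by
    rw [← ENNReal.rpow_add _ _ hJ0 hJtop]
    have : 1 / p + s = 1 := by rw [hs]; field_simp; ring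
    rw [this, ENNReal.rpow_one]
  have hdiv : J ^ (1 / p) ≤ ENNReal.ofReal (p * (Q * V) ^ s / b) *
      weightedEnergy μ ρ p α u ^ (1 / p) := by
    refine (ENNReal.mul_le_mul_iff_left (c := J ^ s) ?_ ?_).1 (by rw [← hsplit]; exact hmain)
    · exact (ENNReal.rpow_pos (pos_iff_ne_zero.2 hJ0) hJtop).ne'
    · exact ENNReal.rpow_ne_top_of_nonneg hs0.le hJtop
  calc _ ≤ ENNReal.ofReal (Q * V) ^ (1 / p) * (ENNReal.ofReal (p * (Q * V) ^ s / b) *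
      weightedEnergy μ ρ p α u ^ (1 / p)) := by gcongr
    _ = _ := by
      rw [← mul_assoc, ENNReal.ofReal_rpow_of_pos hA, ← ENNReal.ofReal_mul (by positivity)]
      congr 2
      have : Q * V = (Q * V) ^ (1 / p) * (Q * V) ^ s := by
        rw [← Real.rpow_add hA]
        have : 1 / p + s = 1 := by rw [hs]; field_simp; ring
        rw [this, Real.rpow_one]
      conv_rhs => rw [this]
      ring

theorem lintegral_Ioi_rpow {a c : ℝ} (ha : a < -1) (hc : 0 < c) :
    ∫⁻ t in Ioi c, ENNReal.ofReal (t ^ a) = ENNReal.ofReal (c ^ (a + 1) / (-(a + 1))) := by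
  rw [← ofReal_integral_eq_lintegral_ofReal (integrableOn_Ioi_rpow_of_lt ha hc),
    integral_Ioi_rpow_of_lt ha hc, neg_div, div_neg]
  filter_upwards [self_mem_ae_restrict measurableSet_Ioi] with x hx
  have : 0 < x := hc.trans hx
  positivity

/-- The constant in `PowerGrowth.hardy` is optimal: the functions `ρ ^ (-s)` on `{1 < ρ}` come
arbitrarily close to it as `s` decreases to the critical exponent `(α + Q) / p`. -/
theorem PowerGrowth.hardyConst_le (h : PowerGrowth μ ρ V Q) {p α : ℝ} (hp : 1 < p)
    (hα : Q * (p - 1) < α) {K : ℝ≥0∞} (hK : TailInequality μ ρ p p α (α - p * Q) K) :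
    ENNReal.ofReal (p * (Q * V) / (α - Q * (p - 1))) ≤ K := by
  have hp0 : 0 < p := by linarith
  have hV := h.const_pos
  have hQ := h.dim_pos
  have hA : 0 < Q * V := by positivity
  have hα' : Q < (α + Q) / p := by rw [lt_div_iff₀ hp0]; linarith
  have key : ∀ s, (α + Q) / p < s → ENNReal.ofReal (Q * V / (s - Q)) ≤ K := by
    intro s hs
    have hsQ : 0 < s - Q := by linarith
    have hd : 0 < s * p - (α + Q) := by
      rw [div_lt_iff₀ hp0] at hs; linarith
    set f : ℝ → ℝ≥0∞ := (Ioi 1).indicator fun r => ENNReal.ofReal (r ^ (-s)) with hf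
    have hfm : Measurable f :=
      (by fun_prop : Measurable fun r : ℝ => ENNReal.ofReal (r ^ (-s))).indicator measurableSet_Ioi
    have hsub : Ioi (1 : ℝ) ⊆ Ioi 0 := Ioi_subset_Ioi zero_le_one
    have hE : weightedEnergy μ ρ p α (fun x => f (ρ x)) =
        ENNReal.ofReal (Q * V / (s * p - (α + Q))) := by
      rw [h.weightedEnergy_comp hfm]
      have e : ∀ r, f r ^ p * ENNReal.ofReal (r ^ (α + Q - 1)) =
          (Ioi 1).indicator (fun r => ENNReal.ofReal (r ^ (-s)) ^ p *
            ENNReal.ofReal (r ^ (α + Q - 1))) r := by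
        intro r
        by_cases hr : r ∈ Ioi (1 : ℝ)
        · rw [hf, indicator_of_mem hr, indicator_of_mem hr]
        · rw [hf, indicator_of_notMem hr, indicator_of_notMem hr, ENNReal.zero_rpow_of_pos hp0,
            zero_mul]
      simp_rw [e]
      rw [setLIntegral_indicator measurableSet_Ioi, inter_eq_self_of_subset_left hsub,
        setLIntegral_congr_fun (g := fun r => ENNReal.ofReal (r ^ (-(s * p) + (α + Q - 1))))
          measurableSet_Ioi, lintegral_Ioi_rpow (by linarith) one_pos, Real.one_rpow,
        ← ENNReal.ofReal_mul hA.le]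
      · congr 1
        rw [mul_one_div]; congr 1; ring
      · intro r hr
        have hr0 : 0 < r := hsub hr
        simp only
        rw [ENNReal.ofReal_rpow_of_pos (by positivity), ← ENNReal.ofReal_mul (by positivity),
          ← Real.rpow_mul hr0.le, ← Real.rpow_add hr0, neg_mul]
    have htail : ∀ r, 1 < r → tailIntegral μ ρ (fun x => f (ρ x)) r =
        ENNReal.ofReal (Q * V / (s - Q)) * ENNReal.ofReal (r ^ (Q - s)) := by
      intro r hr
      have hr0 : 0 < r := by linarith
      rw [h.tailIntegral_comp hfm hr0, setLIntegral_congr_fun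
        (g := fun t => ENNReal.ofReal (Q * V) * ENNReal.ofReal (t ^ (Q - 1 - s)))
          measurableSet_Ioi, lintegral_const_mul' _ _ ENNReal.ofReal_ne_top,
          lintegral_Ioi_rpow (by linarith) hr0, ← ENNReal.ofReal_mul hA.le,
          ← ENNReal.ofReal_mul (by positivity)]
      · congr 1
        rw [show Q - 1 - s + 1 = Q - s by ring, show -(Q - s) = s - Q by ring]; ring
      · intro t ht
        have ht1 : t ∈ Ioi (1 : ℝ) := hr.trans ht
        have ht0 : 0 < t := hsub ht1
        simp only
        rw [hf, indicator_of_mem ht1, ← ENNReal.ofReal_mul (by positivity),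
          ← ENNReal.ofReal_mul hA.le, mul_assoc, ← Real.rpow_add ht0, sub_eq_add_neg (Q - 1) s]
    have hTE : ENNReal.ofReal (Q * V / (s - Q)) ^ p *
        weightedEnergy μ ρ p α (fun x => f (ρ x)) ≤
        tailEnergy μ ρ p (α - p * Q) (fun x => f (ρ x)) := by
      have e0 : Q * V / (s * p - (α + Q)) = Q * V * (s * p - (α + Q))⁻¹ := div_eq_mul_inv _ _
      rw [h.tailEnergy_eq, hE, e0, ENNReal.ofReal_mul hA.le, mul_left_comm]
      refine mul_le_mul' le_rfl ?_
      refine le_trans (le_of_eq ?_) (lintegral_mono_set hsub)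
      have e : ENNReal.ofReal ((s * p - (α + Q))⁻¹) =
          ∫⁻ r in Ioi 1, ENNReal.ofReal (r ^ ((Q - s) * p + (α - p * Q + Q - 1))) := by
        rw [lintegral_Ioi_rpow (by linarith) one_pos, Real.one_rpow, one_div]
        congr 2; ring
      rw [e, ← lintegral_const_mul' _ _ (ENNReal.rpow_ne_top_of_nonneg hp0.le
        ENNReal.ofReal_ne_top)]
      refine setLIntegral_congr_fun measurableSet_Ioi fun r hr => ?_
      have hr0 : 0 < r := hsub hr
      rw [htail r hr, ENNReal.mul_rpow_of_nonneg _ _ hp0.le,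
        ENNReal.ofReal_rpow_of_pos (p := p) (x := r ^ (Q - s)) (by positivity), mul_assoc,
        ← ENNReal.ofReal_mul (by positivity),
        ← Real.rpow_mul hr0.le, ← Real.rpow_add hr0]
    have hkey := hK (fun x => f (ρ x)) (hfm.comp h.measurable)
      (by rw [hE]; exact ENNReal.ofReal_ne_top)
    have h2 := (ENNReal.rpow_le_rpow hTE (by positivity : 0 ≤ 1 / p)).trans hkey
    rw [ENNReal.mul_rpow_of_nonneg _ _ (by positivity), ← ENNReal.rpow_mul,
      mul_one_div_cancel hp0.ne', ENNReal.rpow_one] at h2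
    refine (ENNReal.mul_le_mul_iff_left ?_ ?_).1 h2
    · rw [hE]
      refine (ENNReal.rpow_pos ?_ ENNReal.ofReal_ne_top).ne'
      rw [ENNReal.ofReal_pos]; positivity
    · rw [hE]; exact ENNReal.rpow_ne_top_of_nonneg (by positivity) ENNReal.ofReal_ne_top
  have hlim : Tendsto (fun s => ENNReal.ofReal (Q * V / (s - Q))) (𝓝[>] ((α + Q) / p))
      (𝓝 (ENNReal.ofReal (Q * V / ((α + Q) / p - Q)))) := by
    refine ENNReal.tendsto_ofReal (Tendsto.mono_left ?_ nhdsWithin_le_nhds)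
    exact tendsto_const_nhds.div (tendsto_id.sub tendsto_const_nhds) (by linarith)
  have e : p * (Q * V) / (α - Q * (p - 1)) = Q * V / ((α + Q) / p - Q) := by
    have h1 : α - Q * (p - 1) ≠ 0 := by linarith
    have h2 : (α + Q) / p - Q = (α - Q * (p - 1)) / p := by field_simp; ring
    rw [h2]; field_simp
  rw [e]
  exact le_of_tendsto hlim (eventually_nhdsWithin_of_forall key)

end

/-! ### Necessary conditions on the exponents -/

theorem eq_zero_of_rpow_le {d M : ℝ} (h : ∀ s : ℝ, 0 < s → s ^ d ≤ M) : d = 0 := by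
  by_contra hd
  have hM : 0 < |M| + 1 := by positivity
  have := h ((|M| + 1) ^ d⁻¹) (by positivity)
  rw [← Real.rpow_mul hM.le, inv_mul_cancel₀ hd, Real.rpow_one] at this
  linarith [le_abs_self M]

section
variable {X : Type*} [MeasurableSpace X] {μ : Measure X} {ρ : X → ℝ} {V Q : ℝ} {u : X → ℝ≥0∞}

theorem min_rpow_mul_le {s r β : ℝ} (hs : 0 < s) (h1 : s / 2 ≤ r) (h2 : r < s) :
    min 1 ((1 / 2) ^ β) * s ^ β ≤ r ^ β := by
  have hr : 0 < r := by linarith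
  rcases le_total 0 β with hβ | hβ
  · calc _ ≤ (1 / 2) ^ β * s ^ β := by gcongr; exact min_le_right _ _
      _ = (s / 2) ^ β := by rw [← Real.mul_rpow (by norm_num) hs.le]; congr 1; ring
      _ ≤ r ^ β := Real.rpow_le_rpow (by linarith) h1 hβ
  · calc _ ≤ 1 * s ^ β := by gcongr; exact min_le_left _ _
      _ = s ^ β := one_mul _
      _ ≤ r ^ β := Real.rpow_le_rpow_of_nonpos hr h2.le hβ

theorem le_max_rpow_mul {s r α : ℝ} (hs : 0 < s) (h1 : s ≤ r) (h2 : r < 2 * s) :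
    r ^ α ≤ max 1 (2 ^ α) * s ^ α := by
  have hr : 0 < r := by linarith
  rcases le_total 0 α with hα | hα
  · calc r ^ α ≤ (2 * s) ^ α := Real.rpow_le_rpow hr.le h2.le hα
      _ = 2 ^ α * s ^ α := Real.mul_rpow (by norm_num) hs.le
      _ ≤ _ := by gcongr; exact le_max_right _ _
  · calc r ^ α ≤ s ^ α := Real.rpow_le_rpow_of_nonpos hs h1 hα
      _ = 1 * s ^ α := (one_mul _).symm
      _ ≤ _ := by gcongr; exact le_max_left _ _

/-- The tails are at least the tail at `s` on the annulus `s / 2 ≤ ρ < s`, whose weighted measure is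
of the order `s ^ (β + Q)`. -/
theorem PowerGrowth.exists_le_tailEnergy (h : PowerGrowth μ ρ V Q) {q : ℝ} (hq : 0 ≤ q) (β : ℝ) :
    ∃ c : ℝ, 0 < c ∧ ∀ (u : X → ℝ≥0∞) (s : ℝ), 0 < s →
      tailIntegral μ ρ u s ^ q * ENNReal.ofReal (c * s ^ (β + Q)) ≤ tailEnergy μ ρ q β u := by
  have hV := h.const_pos
  have hQ := h.dim_pos
  have hhalf : (1 / 2 : ℝ) ^ Q < 1 := Real.rpow_lt_one (by norm_num) (by norm_num) hQ
  have hmin : 0 < min 1 ((1 / 2 : ℝ) ^ β) := lt_min one_pos (by positivity)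
  refine ⟨min 1 ((1 / 2) ^ β) * (V * (1 - (1 / 2) ^ Q)),
    mul_pos hmin (mul_pos hV (by linarith)), fun u s hs => ?_⟩
  have hS : MeasurableSet {x | s / 2 ≤ ρ x ∧ ρ x < s} :=
    (measurableSet_le measurable_const h.measurable).inter
      (measurableSet_lt h.measurable measurable_const)
  refine le_trans (le_of_eq ?_) ((setLIntegral_mono' hS fun x hx => mul_le_mul'
    (ENNReal.rpow_le_rpow (tailIntegral_antitone μ ρ u hx.2.le) hq)
    (ENNReal.ofReal_le_ofReal (min_rpow_mul_le (β := β) hs hx.1 hx.2))).trans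
    (setLIntegral_le_lintegral _ _))
  rw [setLIntegral_const, h.measure_Ico (by linarith) (by linarith),
    mul_assoc (tailIntegral μ ρ u s ^ q),
    ← ENNReal.ofReal_mul (by positivity)]
  congr 2
  rw [Real.rpow_add hs, show s / 2 = 1 / 2 * s by ring, Real.mul_rpow (by norm_num) hs.le]
  ring

/-- The relation between the exponents is necessary: the indicator functions of the annuli
`s ≤ ρ < 2 s` show that a power of `s` stays bounded for all `s > 0`. -/
theorem PowerGrowth.homogeneity_of_tailInequality (h : PowerGrowth μ ρ V Q) {p q α β : ℝ}
    (hp : 1 < p) (hq : 0 < q) {K : ℝ≥0∞} (hKtop : K ≠ ⊤) (hK : TailInequality μ ρ p q α β K) :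
    q * (α + Q) - p * (β + Q) = p * q * Q := by
  have hp0 : 0 < p := by linarith
  have hV := h.const_pos
  have hQ := h.dim_pos
  obtain ⟨c, hc, hlow⟩ := h.exists_le_tailEnergy hq.le β
  have h2Q : 1 < (2 : ℝ) ^ Q := Real.one_lt_rpow (by norm_num) hQ
  set c₀ := V * (2 ^ Q - 1) with hc₀
  have hc₀pos : 0 < c₀ := mul_pos hV (by linarith)
  set M := max 1 ((2 : ℝ) ^ α) with hM
  have hMpos : 0 < M := lt_max_of_lt_left one_pos
  have hbound : ∀ s : ℝ, 0 < s →
      s ^ (Q + (β + Q) / q - (α + Q) / p) ≤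
        K.toReal * (M * c₀) ^ (1 / p) / (c₀ * c ^ (1 / q)) := by
    intro s hs
    set S := {x | s ≤ ρ x ∧ ρ x < 2 * s} with hS
    have hSm : MeasurableSet S :=
      (measurableSet_le measurable_const h.measurable).inter
        (measurableSet_lt h.measurable measurable_const)
    have hμS : μ S = ENNReal.ofReal (c₀ * s ^ Q) := by
      rw [hS, h.measure_Ico hs.le (by linarith)]
      congr 1
      rw [Real.mul_rpow (by norm_num) hs.le, hc₀]; ring
    have htail : tailIntegral μ ρ (S.indicator 1) s = ENNReal.ofReal (c₀ * s ^ Q) := by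
      have hsub : S ⊆ {y | s ≤ ρ y} := fun x hx => hx.1
      unfold tailIntegral
      rw [setLIntegral_indicator hSm, inter_eq_self_of_subset_left hsub]
      simp [hμS]
    have hE : weightedEnergy μ ρ p α (S.indicator 1) ≤
        ENNReal.ofReal (M * c₀ * s ^ (α + Q)) := by
      have e : ∀ x, S.indicator (1 : X → ℝ≥0∞) x ^ p * ENNReal.ofReal (ρ x ^ α) =
          S.indicator (fun x => ENNReal.ofReal (ρ x ^ α)) x := by
        intro x
        by_cases hx : x ∈ S
        · simp [hx]
        · simp [hx, hp0]
      unfold weightedEnergy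
      simp_rw [e]
      rw [lintegral_indicator hSm]
      refine (setLIntegral_mono' hSm fun x hx => ENNReal.ofReal_le_ofReal
        (le_max_rpow_mul (α := α) hs hx.1 hx.2)).trans (le_of_eq ?_)
      rw [setLIntegral_const, hμS, ← ENNReal.ofReal_mul (by positivity)]
      congr 1
      rw [Real.rpow_add hs]; ring
    have h1 := hK (S.indicator 1) (measurable_one.indicator hSm)
      (ne_top_of_le_ne_top ENNReal.ofReal_ne_top hE)
    have h2 := (ENNReal.rpow_le_rpow (hlow (S.indicator 1) s hs) (by positivity : 0 ≤ 1 / q)).trans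
      (h1.trans (mul_le_mul' le_rfl (ENNReal.rpow_le_rpow hE (by positivity : 0 ≤ 1 / p))))
    rw [htail, ENNReal.mul_rpow_of_nonneg _ _ (by positivity), ← ENNReal.rpow_mul,
      mul_one_div_cancel hq.ne', ENNReal.rpow_one, ENNReal.ofReal_rpow_of_pos (by positivity),
      ENNReal.ofReal_rpow_of_pos (by positivity), ← ENNReal.ofReal_mul (by positivity),
      ← ENNReal.ofReal_toReal hKtop, ← ENNReal.ofReal_mul ENNReal.toReal_nonneg,
      ENNReal.ofReal_le_ofReal_iff (by positivity), Real.mul_rpow (by positivity) (by positivity),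
      Real.mul_rpow (by positivity) (by positivity), ← Real.rpow_mul hs.le, ← Real.rpow_mul hs.le,
      mul_one_div, mul_one_div] at h2
    rw [Real.rpow_sub hs, Real.rpow_add hs, le_div_iff₀ (by positivity), div_mul_eq_mul_div,
      div_le_iff₀ (by positivity)]
    calc _ = c₀ * s ^ Q * (c ^ (1 / q) * s ^ ((β + Q) / q)) := by ring
      _ ≤ _ := h2
      _ = _ := by ring
  have := eq_zero_of_rpow_le hbound
  field_simp at this
  linarith

/-- The condition on `α` is necessary: if it fails, the functions `ρ ^ (-Q)` on `1 < ρ ≤ R` have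
energy at most `t` and mass equal to `t`, where `t = Q V log R` is arbitrarily large. -/
theorem PowerGrowth.lt_of_tailInequality (h : PowerGrowth μ ρ V Q) {p q α β : ℝ}
    (hp : 1 < p) (hq : 0 < q) {K : ℝ≥0∞} (hKtop : K ≠ ⊤) (hK : TailInequality μ ρ p q α β K) :
    Q * (p - 1) < α := by
  by_contra hα
  rw [not_lt] at hα
  have hp0 : 0 < p := by linarith
  have hV := h.const_pos
  have hQ := h.dim_pos
  have hA : 0 < Q * V := by positivity
  obtain ⟨c, hc, hlow⟩ := h.exists_le_tailEnergy hq.le β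
  have hbound : ∀ t : ℝ, 0 < t → t ^ (1 - 1 / p) ≤ K.toReal / c ^ (1 / q) := by
    intro t ht
    set R := Real.exp (t / (Q * V)) with hR
    have hR1 : 1 ≤ R := Real.one_le_exp (by positivity)
    have hlog : ∫⁻ r in Ioc 1 R, ENNReal.ofReal (Q * V * r⁻¹) = ENNReal.ofReal t := by
      rw [← ofReal_integral_eq_lintegral_ofReal, ← intervalIntegral.integral_of_le hR1,
        intervalIntegral.integral_const_mul, integral_inv_of_pos one_pos (by positivity), div_one,
        hR, Real.log_exp]
      · congr 1; field_simp
      · rw [← IntegrableOn, ← intervalIntegrable_iff_integrableOn_Ioc_of_le hR1]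
        refine (intervalIntegral.intervalIntegrable_inv (fun x hx => ?_) continuousOn_id).const_mul _
        rw [uIcc_of_le hR1] at hx
        have := hx.1
        simp only [id]; linarith
      · filter_upwards [self_mem_ae_restrict measurableSet_Ioc] with x hx
        have : (1 : ℝ) < x := hx.1
        have : 0 < x := by linarith
        positivity
    set f : ℝ → ℝ≥0∞ := (Ioc 1 R).indicator fun r => ENNReal.ofReal (r ^ (-Q)) with hf
    have hfm : Measurable f :=
      (by fun_prop : Measurable fun r : ℝ => ENNReal.ofReal (r ^ (-Q))).indicator measurableSet_Ioc
    have htail : tailIntegral μ ρ (fun x => f (ρ x)) 1 = ENNReal.ofReal t := by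
      rw [h.tailIntegral_comp hfm one_pos, ← hlog]
      have e : ∀ s, ENNReal.ofReal (Q * V * s ^ (Q - 1)) * f s =
          (Ioc 1 R).indicator (fun s => ENNReal.ofReal (Q * V * s⁻¹)) s := by
        intro s
        by_cases hs : s ∈ Ioc 1 R
        · have hs0 : 0 < s := by have := hs.1; linarith
          rw [hf, indicator_of_mem hs, indicator_of_mem hs, ← ENNReal.ofReal_mul (by positivity),
            mul_assoc, ← Real.rpow_add hs0, ← Real.rpow_neg_one]
          congr 3; ring
        · rw [hf, indicator_of_notMem hs, indicator_of_notMem hs, mul_zero]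
      simp_rw [e]
      rw [setLIntegral_indicator measurableSet_Ioc,
        inter_eq_self_of_subset_left (show Ioc 1 R ⊆ Ioi 1 from Ioc_subset_Ioi_self)]
    have hE : weightedEnergy μ ρ p α (fun x => f (ρ x)) ≤ ENNReal.ofReal t := by
      rw [h.weightedEnergy_comp hfm, ← hlog, ← lintegral_const_mul' _ _ ENNReal.ofReal_ne_top]
      have hsub : Ioc 1 R ⊆ Ioi 0 := fun r hr => by have := hr.1; exact mem_Ioi.2 (by linarith)
      rw [← inter_eq_self_of_subset_left hsub, ← setLIntegral_indicator measurableSet_Ioc]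
      refine setLIntegral_mono' measurableSet_Ioi fun r _ => ?_
      by_cases hr : r ∈ Ioc 1 R
      · have hr1 : 1 ≤ r := hr.1.le
        have hr0 : 0 < r := by linarith
        rw [hf, indicator_of_mem hr, indicator_of_mem hr, ENNReal.ofReal_rpow_of_pos (by positivity),
          ← ENNReal.ofReal_mul (by positivity), ← ENNReal.ofReal_mul hA.le, ← Real.rpow_mul hr0.le,
          ← Real.rpow_add hr0, ← Real.rpow_neg_one r]
        gcongr
        linarith
      · rw [hf, indicator_of_notMem hr, indicator_of_notMem hr, ENNReal.zero_rpow_of_pos hp0,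
          zero_mul, mul_zero]
    have h1 := hK (fun x => f (ρ x)) (hfm.comp h.measurable)
      (ne_top_of_le_ne_top ENNReal.ofReal_ne_top hE)
    have h2 := (ENNReal.rpow_le_rpow (hlow (fun x => f (ρ x)) 1 one_pos)
      (by positivity : 0 ≤ 1 / q)).trans
      (h1.trans (mul_le_mul' le_rfl (ENNReal.rpow_le_rpow hE (by positivity : 0 ≤ 1 / p))))
    rw [htail, ENNReal.mul_rpow_of_nonneg _ _ (by positivity), ← ENNReal.rpow_mul,
      mul_one_div_cancel hq.ne', ENNReal.rpow_one, Real.one_rpow, mul_one,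
      ENNReal.ofReal_rpow_of_pos hc,
      ENNReal.ofReal_rpow_of_pos ht, ← ENNReal.ofReal_mul ht.le,
      ← ENNReal.ofReal_toReal hKtop, ← ENNReal.ofReal_mul ENNReal.toReal_nonneg,
      ENNReal.ofReal_le_ofReal_iff (by positivity)] at h2
    rw [Real.rpow_sub ht, Real.rpow_one, le_div_iff₀ (by positivity), div_mul_eq_mul_div,
      div_le_iff₀ (by positivity)]
    exact h2
  have := eq_zero_of_rpow_le hbound
  rw [sub_eq_zero, eq_comm, div_eq_one_iff_eq hp0.ne'] at this
  linarith

end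

/-! ### Homogeneous groups -/

namespace HomogeneousGroup

variable {N : ℕ} {G : HomogeneousGroup N}

theorem homDim_pos (hN : 0 < N) (G : HomogeneousGroup N) : 0 < G.homDim :=
  Finset.sum_pos (fun i _ => G.weight_pos i) ⟨⟨0, hN⟩, Finset.mem_univ _⟩

theorem volume_preimage_dil (G : HomogeneousGroup N) {t : ℝ} (ht : 0 < t)
    (s : Set (Fin N → ℝ)) :
    volume (G.dil t ⁻¹' s) = ENNReal.ofReal (t⁻¹ ^ G.homDim) * volume s := by
  set L : (Fin N → ℝ) →ₗ[ℝ] (Fin N → ℝ) :=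
    Matrix.toLin' (Matrix.diagonal fun i => t ^ G.weight i) with hL
  have hfun : ∀ x, L x = G.dil t x := by
    intro x; ext i
    simp [hL, Matrix.mulVec_diagonal, dil, dilation]
  have hdet : LinearMap.det L = t ^ G.homDim := by
    rw [hL, LinearMap.det_toLin', Matrix.det_diagonal, homDim, Real.rpow_sum_of_pos ht]
  have hpos : 0 < t ^ G.homDim := by positivity
  have h1 : G.dil t ⁻¹' s = L ⁻¹' s := by ext x; simp [hfun]
  rw [h1, Measure.addHaar_preimage_linearMap _ (by rw [hdet]; exact hpos.ne'), hdet,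
    abs_of_pos (by positivity), Real.inv_rpow ht.le]

namespace QuasiNorm

/-- Small quasi-balls are bounded: the path `t ↦ D_t x` from the origin to a point outside the
Euclidean unit ball meets the unit sphere, on which the quasi-norm has a positive minimum. -/
theorem exists_ball_subset (ν : G.QuasiNorm) :
    ∃ δ : ℝ, 0 < δ ∧ ν.ball δ ⊆ Metric.ball 0 1 := by
  rcases (Metric.sphere (0 : Fin N → ℝ) 1).eq_empty_or_nonempty with he | hne
  · -- the sphere is empty only for `N = 0`, when the space is a point
    refine ⟨1, one_pos, fun x _ => ?_⟩
    rw [mem_ball_zero_iff]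
    by_contra hx
    have hx0 : ‖x‖ ≠ 0 := by linarith [not_lt.1 hx]
    have : (‖x‖⁻¹ • x) ∈ Metric.sphere (0 : Fin N → ℝ) 1 := by
      rw [mem_sphere_zero_iff_norm, norm_smul, norm_inv, norm_norm, inv_mul_cancel₀ hx0]
    rw [he] at this; exact this
  obtain ⟨z, hz, hmin⟩ := (isCompact_sphere (0 : Fin N → ℝ) 1).exists_isMinOn hne
    ν.continuous_toFun.continuousOn
  have hz0 : z ≠ 0 := by
    rintro rfl; simp at hz
  have hδ : 0 < ν.toFun z := (ν.nonneg z).lt_of_ne' fun h => hz0 ((ν.eq_zero_iff z).1 h)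
  refine ⟨ν.toFun z, hδ, fun x hx => ?_⟩
  rw [mem_ball_zero_iff]
  by_contra hx1
  rw [not_lt] at hx1
  -- the dilation path from `0` to `x` crosses the sphere
  have hcont : ContinuousOn (fun t : ℝ => ‖G.dil t x‖) (Icc 0 1) := by
    refine Continuous.continuousOn (continuous_norm.comp (continuous_pi fun i => ?_))
    exact (Real.continuous_rpow_const (G.weight_pos i).le).mul continuous_const
  have h0 : ‖G.dil 0 x‖ = 0 := by
    rw [norm_eq_zero]; ext i
    simp [dil, dilation, Real.zero_rpow (G.weight_pos i).ne']
  have h1 : ‖G.dil 1 x‖ = ‖x‖ := by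
    congr 1; ext i; simp [dil, dilation]
  obtain ⟨t, ht, htx⟩ := intermediate_value_Icc (zero_le_one' ℝ) hcont
    (show (1 : ℝ) ∈ Icc _ _ from ⟨by rw [h0]; exact zero_le_one, by rw [h1]; exact hx1⟩)
  have ht0 : 0 < t := by
    rcases ht.1.eq_or_lt with h | h
    · subst h; simp only [h0] at htx; linarith
    · exact h
  have h2 : ν.toFun z ≤ ν.toFun (G.dil t x) := hmin (by simpa using htx)
  rw [ν.map_dil t ht0] at h2
  have h3 : ν.toFun x < ν.toFun z := hx
  nlinarith [ν.nonneg x, ht.2]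

theorem volume_ball (ν : G.QuasiNorm) {s r : ℝ} (hr : 0 < r) :
    volume (ν.ball (r * s)) = ENNReal.ofReal (r ^ G.homDim) * volume (ν.ball s) := by
  have h1 : ν.ball (r * s) = G.dil r⁻¹ ⁻¹' ν.ball s := by
    ext x
    change ν.toFun x < r * s ↔ ν.toFun (G.dil r⁻¹ x) < s
    rw [ν.map_dil _ (inv_pos.2 hr), inv_mul_lt_iff₀ hr]
  rw [h1, G.volume_preimage_dil (inv_pos.2 hr), inv_inv]

theorem volume_ball_ne_top (ν : G.QuasiNorm) (r : ℝ) : volume (ν.ball r) ≠ ⊤ := by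
  obtain ⟨δ, hδ, hsub⟩ := ν.exists_ball_subset
  rcases le_or_gt r 0 with hr | hr
  · have : ν.ball r = ∅ := by
      ext x
      simp only [ball, mem_ofPred_eq, mem_empty_iff_false, iff_false, not_lt]
      exact hr.trans (ν.nonneg x)
    rw [this]; simp
  have h1 : r = (r / δ) * δ := by field_simp
  rw [h1, ν.volume_ball (div_pos hr hδ)]
  exact ENNReal.mul_ne_top ENNReal.ofReal_ne_top
    (ne_top_of_le_ne_top measure_ball_lt_top.ne (measure_mono hsub))

theorem toFun_zero (ν : G.QuasiNorm) : ν.toFun 0 = 0 := (ν.eq_zero_iff 0).2 rfl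

/-- Lebesgue measure grows along the quasi-norm like the power `Q`, the homogeneous dimension. -/
theorem powerGrowth (hN : 0 < N) (ν : G.QuasiNorm) :
    PowerGrowth volume ν.toFun (volume.real (ν.ball 1)) G.homDim where
  measurable := ν.continuous_toFun.measurable
  nonneg := ν.nonneg
  const_pos := by
    refine ENNReal.toReal_pos (IsOpen.measure_pos volume ?_ ⟨0, ?_⟩).ne' (ν.volume_ball_ne_top 1)
    · exact isOpen_Iio.preimage ν.continuous_toFun
    · change ν.toFun 0 < 1
      rw [ν.toFun_zero]; exact one_pos
  dim_pos := homDim_pos hN G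
  measure_lt r hr := by
    have := ν.volume_ball (s := 1) hr
    rw [mul_one] at this
    change volume (ν.ball r) = _
    rw [this, mul_comm (volume.real _), ENNReal.ofReal_mul (by positivity),
      ofReal_measureReal (ν.volume_ball_ne_top 1)]

theorem sphereArea_eq (hN : 0 < N) (ν : G.QuasiNorm) :
    ν.sphereArea = G.homDim * volume.real (ν.ball 1) := by
  have hQ := homDim_pos hN G
  have hmeas : Measurable fun x => G.dil (ν.toFun x)⁻¹ x := by
    have := ν.continuous_toFun.measurable
    refine measurable_pi_lambda _ fun i => ?_
    change Measurable fun x : Fin N → ℝ => (ν.toFun x)⁻¹ ^ G.weight i * x i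
    fun_prop
  have hS : MeasurableSet ν.unitSphere :=
    (isClosed_singleton.preimage ν.continuous_toFun).measurableSet (s := ν.toFun ⁻¹' {1})
  have hB : MeasurableSet (ν.ball 1 \ {0}) :=
    (isOpen_Iio.preimage ν.continuous_toFun).measurableSet.diff (measurableSet_singleton 0)
  have hset : (fun x => G.dil (ν.toFun x)⁻¹ x) ⁻¹' ν.unitSphere ∩ (ν.ball 1 \ {0}) =
      ν.ball 1 \ {0} := by
    refine inter_eq_self_of_subset_right fun x hx => ?_
    have hx0 : x ≠ 0 := hx.2
    have hpos : 0 < ν.toFun x := (ν.nonneg x).lt_of_ne' fun h => hx0 ((ν.eq_zero_iff x).1 h)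
    change ν.toFun (G.dil (ν.toFun x)⁻¹ x) = 1
    rw [ν.map_dil _ (inv_pos.2 hpos), inv_mul_cancel₀ hpos.ne']
  have : Nonempty (Fin N) := ⟨⟨0, hN⟩⟩
  unfold sphereArea sphereMeasure
  rw [measureReal_ennreal_smul_apply, ENNReal.toReal_ofReal hQ.le, Measure.real,
    Measure.map_apply hmeas hS, Measure.restrict_apply (hmeas hS), hset,
    measure_sdiff_null (measure_singleton 0), Measure.real]

theorem ball_compl (ν : G.QuasiNorm) (r : ℝ) : (ν.ball r)ᶜ = {y | r ≤ ν.toFun y} := by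
  ext y; simp [ball]

/-- The inequality for `𝕜`-valued functions is equivalent to the one for nonnegative functions. In one
direction a nonnegative function of finite energy is finite almost everywhere; in the other, a
finite tail energy makes every tail finite, which is the convergence of the inner integral. -/
theorem conjugateHardyInequality_iff (hN : 0 < N) (ν : G.QuasiNorm) (𝕜 : Type*) [RCLike 𝕜]
    {p q α β C : ℝ} (hp : 0 < p) (hq : 0 < q) :
    ν.ConjugateHardyInequality 𝕜 p q α β C ↔
      TailInequality volume ν.toFun p q α β (ENNReal.ofReal C) := by
  have hg := ν.powerGrowth hN
  constructor
  · intro H u hu hE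
    set f : (Fin N → ℝ) → 𝕜 := fun x => ((u x).toReal : 𝕜) with hf
    have hfm : Measurable f := RCLike.measurable_ofReal.comp hu.ennreal_toReal
    have hfn : ∀ x, ‖f x‖ₑ = ENNReal.ofReal (u x).toReal := by
      intro x
      rw [← ofReal_norm, hf, RCLike.norm_ofReal, abs_of_nonneg ENNReal.toReal_nonneg]
    have hae : ∀ᵐ x, ‖f x‖ₑ = u x := by
      have hm : Measurable fun x => u x ^ p * ENNReal.ofReal (ν.toFun x ^ α) := by
        have := ν.continuous_toFun.measurable
        fun_prop
      filter_upwards [ae_lt_top hm hE, hg.ae_pos] with x hx hx0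
      rw [hfn]
      refine ENNReal.ofReal_toReal fun htop => ?_
      rw [htop, ENNReal.top_rpow_of_pos hp, ENNReal.top_mul] at hx
      · exact lt_irrefl _ hx
      · rw [ne_eq, ENNReal.ofReal_eq_zero, not_le]; positivity
    have hE' : ∫⁻ x, ‖f x‖ₑ ^ p * ENNReal.ofReal (ν.toFun x ^ α) =
        weightedEnergy volume ν.toFun p α u :=
      lintegral_congr_ae (hae.mono fun x hx => by simp only [hx])
    obtain ⟨hint, hineq⟩ := H f hfm (by rw [hE']; exact hE)
    rw [hE'] at hineq
    refine le_trans (le_of_eq ?_) hineq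
    congr 1
    refine lintegral_congr_ae ?_
    filter_upwards [hg.ae_pos] with x hx
    have hx0 : x ≠ 0 := by rintro rfl; rw [ν.toFun_zero] at hx; exact lt_irrefl _ hx
    have hi := hint x hx0
    congr 2
    have h1 : ∫ y in (ν.ball (ν.toFun x))ᶜ, f y =
        ((∫ y in (ν.ball (ν.toFun x))ᶜ, (u y).toReal : ℝ) : 𝕜) := integral_ofReal
    have h2 : IntegrableOn (fun y => (u y).toReal) (ν.ball (ν.toFun x))ᶜ := by
      have := hi.norm
      refine this.congr (Eventually.of_forall fun y => ?_)
      simp only [hf, RCLike.norm_ofReal, abs_of_nonneg ENNReal.toReal_nonneg]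
    rw [h1, ← ofReal_norm, RCLike.norm_ofReal,
      abs_of_nonneg (integral_nonneg fun _ => ENNReal.toReal_nonneg),
      ofReal_integral_eq_lintegral_ofReal h2 (Eventually.of_forall fun _ => ENNReal.toReal_nonneg),
      ball_compl]
    refine lintegral_congr_ae (ae_restrict_of_ae (hae.mono fun y hy => ?_))
    exact hy.symm.trans (hfn y)
  · intro H u hu hE
    have hmain := H (fun x => ‖u x‖ₑ) hu.enorm hE
    have hfin : tailEnergy volume ν.toFun q β (fun x => ‖u x‖ₑ) ≠ ⊤ := by
      intro htop
      rw [htop, ENNReal.top_rpow_of_pos (by positivity), top_le_iff] at hmain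
      exact ENNReal.mul_ne_top ENNReal.ofReal_ne_top
        (ENNReal.rpow_ne_top_of_nonneg (by positivity) hE) hmain
    have htail : ∀ r, 0 < r → tailIntegral volume ν.toFun (fun x => ‖u x‖ₑ) r ≠ ⊤ := by
      intro r hr htop
      obtain ⟨c, hc, hlow⟩ := hg.exists_le_tailEnergy hq.le β
      have := hlow (fun x => ‖u x‖ₑ) r hr
      rw [htop, ENNReal.top_rpow_of_pos hq, ENNReal.top_mul, top_le_iff] at this
      · exact hfin this
      · rw [ne_eq, ENNReal.ofReal_eq_zero, not_le]; positivity
    refine ⟨fun x hx => ⟨hu.aestronglyMeasurable, ?_⟩, le_trans ?_ hmain⟩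
    · have hpos : 0 < ν.toFun x := (ν.nonneg x).lt_of_ne' fun h => hx ((ν.eq_zero_iff x).1 h)
      rw [HasFiniteIntegral, ball_compl]
      exact (htail _ hpos).lt_top
    · refine ENNReal.rpow_le_rpow (lintegral_mono fun x => ?_) (by positivity)
      refine mul_le_mul' (ENNReal.rpow_le_rpow ?_ hq.le) le_rfl
      rw [ball_compl]
      exact enorm_integral_le_lintegral_enorm _

end QuasiNorm

end HomogeneousGroup

/-! ### The Gamma function at infinity and the sharp constant -/

/-- A lower bound for the Gamma integral, from its part over `(x, ∞)`. -/
theorem rpow_mul_exp_le_Gamma {x : ℝ} (hx : 0 < x) :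
    x ^ x * Real.exp (-x) ≤ Real.Gamma (x + 1) := by
  rw [Real.Gamma_eq_integral (by linarith), add_sub_cancel_right]
  have hint : IntegrableOn (fun t => Real.exp (-t) * t ^ x) (Ioi 0) := by
    have := Real.GammaIntegral_convergent (s := x + 1) (by linarith)
    rwa [add_sub_cancel_right] at this
  have hsub : Ioi x ⊆ Ioi 0 := Ioi_subset_Ioi hx.le
  calc x ^ x * Real.exp (-x) = ∫ t in Ioi x, x ^ x * Real.exp (-t) := by
        rw [integral_const_mul, integral_exp_neg_Ioi]
    _ ≤ ∫ t in Ioi x, Real.exp (-t) * t ^ x := by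
        refine setIntegral_mono_on ((integrableOn_exp_neg_Ioi x).const_mul _) (hint.mono_set hsub)
          measurableSet_Ioi fun t ht => ?_
        have : x ≤ t := le_of_lt ht
        rw [mul_comm]
        gcongr
    _ ≤ _ := by
        refine setIntegral_mono_set hint ?_ hsub.eventuallyLE
        filter_upwards [self_mem_ae_restrict measurableSet_Ioi] with t ht
        have : 0 < t := ht
        positivity

theorem Gamma_le_rpow_mul_exp {x : ℝ} (hx : 0 < x) :
    Real.Gamma (x + 1) ≤ (x + 1) ^ (x + 1) * Real.exp (-x) := by
  have hx1 : 0 < x + 1 := by linarith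
  rw [Real.Gamma_eq_integral hx1, add_sub_cancel_right]
  have hint : IntegrableOn (fun t => Real.exp (-t) * t ^ x) (Ioi 0) := by
    have := Real.GammaIntegral_convergent (s := x + 1) (by linarith)
    rwa [add_sub_cancel_right] at this
  have hneg : -(x + 1)⁻¹ < 0 := by
    have := inv_pos.2 hx1; linarith
  calc ∫ t in Ioi 0, Real.exp (-t) * t ^ x
      ≤ ∫ t in Ioi 0, ((x + 1) ^ x * Real.exp (-x)) * Real.exp (-(x + 1)⁻¹ * t) := by
        refine setIntegral_mono_on hint ((integrableOn_exp_mul_Ioi hneg 0).const_mul _)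
          measurableSet_Ioi fun t ht => ?_
        have ht0 : 0 < t := ht
        -- `y ≤ exp (y - 1)` with `y = t / (x + 1)`
        have h1 : t / (x + 1) ≤ Real.exp (t / (x + 1) - 1) := by
          have := Real.add_one_le_exp (t / (x + 1) - 1)
          linarith
        have h2 : (t / (x + 1)) ^ x ≤ Real.exp (t / (x + 1) - 1) ^ x :=
          Real.rpow_le_rpow (by positivity) h1 hx.le
        rw [Real.div_rpow ht0.le hx1.le, div_le_iff₀ (by positivity), ← Real.exp_mul] at h2
        calc Real.exp (-t) * t ^ x ≤
            Real.exp (-t) * (Real.exp ((t / (x + 1) - 1) * x) * (x + 1) ^ x) := by gcongr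
          _ = (x + 1) ^ x * (Real.exp (-t) * Real.exp ((t / (x + 1) - 1) * x)) := by ring
          _ = (x + 1) ^ x * (Real.exp (-x) * Real.exp (-(x + 1)⁻¹ * t)) := by
              rw [← Real.exp_add, ← Real.exp_add]
              congr 2
              field_simp; ring
          _ = _ := by ring
    _ = _ := by
        rw [integral_const_mul, integral_exp_mul_Ioi hneg, Real.rpow_add_one hx1.ne']
        rw [mul_zero, Real.exp_zero]
        field_simp

/-- Stirling's formula to leading order: `log Γ(x) = x log x - x + o(x)`. -/
theorem tendsto_log_Gamma_div_sub_log :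
    Tendsto (fun x : ℝ => Real.log (Real.Gamma x) / x - Real.log x) atTop (𝓝 (-1)) := by
  have hl : Tendsto (fun x : ℝ => Real.log x / x) atTop (𝓝 0) :=
    Real.isLittleO_log_id_atTop.tendsto_div_nhds_zero
  have hinv : Tendsto (fun x : ℝ => 1 + 1 / x) atTop (𝓝 1) := by
    have : Tendsto (fun x : ℝ => 1 / x) atTop (𝓝 0) := by
      simpa using tendsto_inv_atTop_zero (𝕜 := ℝ)
    simpa using this.const_add 1
  have hlog1 : Tendsto (fun x : ℝ => Real.log (1 + 1 / x)) atTop (𝓝 0) := by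
    have := (Real.continuousAt_log one_ne_zero).tendsto.comp hinv
    simpa [Function.comp_def] using this
  have hlow : Tendsto (fun x : ℝ => -1 - Real.log x / x) atTop (𝓝 (-1)) := by
    simpa using hl.const_sub (-1)
  have hup : Tendsto (fun x : ℝ => -1 + (1 + 1 / x) * Real.log (1 + 1 / x)) atTop (𝓝 (-1)) := by
    have := (hinv.mul hlog1).const_add (-1)
    simpa using this
  refine tendsto_of_tendsto_of_tendsto_of_le_of_le' hlow hup ?_ ?_
  · filter_upwards [eventually_gt_atTop 0] with x hx
    have h1 := Real.log_le_log (by positivity) (rpow_mul_exp_le_Gamma hx)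
    rw [Real.Gamma_add_one hx.ne', Real.log_mul (by positivity) (Real.exp_pos _).ne',
      Real.log_mul hx.ne' (Real.Gamma_pos_of_pos hx).ne', Real.log_exp, Real.log_rpow hx] at h1
    rw [le_sub_iff_add_le, le_div_iff₀ hx]
    have : (-1 - Real.log x / x + Real.log x) * x = -x - Real.log x + x * Real.log x := by
      field_simp
    linarith
  · filter_upwards [eventually_gt_atTop 0] with x hx
    have hx1 : 0 < x + 1 := by linarith
    have h1 := Real.log_le_log (Real.Gamma_pos_of_pos hx1) (Gamma_le_rpow_mul_exp hx)
    rw [Real.Gamma_add_one hx.ne', Real.log_mul (by positivity) (Real.exp_pos _).ne',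
      Real.log_mul hx.ne' (Real.Gamma_pos_of_pos hx).ne', Real.log_exp, Real.log_rpow hx1] at h1
    have e : Real.log (1 + 1 / x) = Real.log (x + 1) - Real.log x := by
      rw [← Real.log_div hx1.ne' hx.ne']; congr 1; field_simp
    rw [e, sub_le_iff_le_add, div_le_iff₀ hx]
    have : (-1 + (1 + 1 / x) * (Real.log (x + 1) - Real.log x) + Real.log x) * x =
        -x + (x + 1) * Real.log (x + 1) - Real.log x := by
      field_simp; ring
    linarith

/-- The limit of the Gamma factor of the sharp constant, in the parameter `h = p / (q - p)`. -/
theorem tendsto_Gamma_factor {q : ℝ} (hq : 1 < q) :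
    Tendsto (fun h : ℝ => (1 / h * Real.Gamma (h * q) /
      (Real.Gamma h * Real.Gamma (h * (q - 1)))) ^ (1 / (h * q))) atTop
      (𝓝 (q * (q - 1) ^ (-((q - 1) / q)))) := by
  have hq0 : 0 < q := by linarith
  have hq1 : 0 < q - 1 := by linarith
  have hl : Tendsto (fun x : ℝ => Real.log x / x) atTop (𝓝 0) :=
    Real.isLittleO_log_id_atTop.tendsto_div_nhds_zero
  have hG := tendsto_log_Gamma_div_sub_log
  have hG1 := hG.comp (tendsto_id.atTop_mul_const hq0)
  have hG2 := hG.comp (tendsto_id.atTop_mul_const hq1)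
  have hsum := ((hG1.sub (hG.const_mul (1 / q))).sub (hG2.const_mul ((q - 1) / q))).sub
    (hl.const_mul (1 / q))
  have hlim := (hsum.add_const (Real.log q - (q - 1) / q * Real.log (q - 1)))
  have hexp := (Real.continuous_exp.tendsto _).comp hlim
  have e : Real.exp (-1 - 1 / q * -1 - (q - 1) / q * -1 - 1 / q * 0 +
      (Real.log q - (q - 1) / q * Real.log (q - 1))) = q * (q - 1) ^ (-((q - 1) / q)) := by
    have h0 : -1 - 1 / q * -1 - (q - 1) / q * -1 - 1 / q * 0 = (0 : ℝ) := by field_simp; ring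
    rw [h0, zero_add, sub_eq_add_neg, Real.exp_add, Real.exp_log hq0, Real.rpow_def_of_pos hq1]
    congr 2; ring
  rw [e] at hexp
  refine hexp.congr' ?_
  filter_upwards [eventually_gt_atTop 0] with h hh
  have g1 := Real.Gamma_pos_of_pos (mul_pos hh hq0)
  have g2 := Real.Gamma_pos_of_pos hh
  have g3 := Real.Gamma_pos_of_pos (mul_pos hh hq1)
  simp only [Function.comp_apply, id]
  rw [Real.rpow_def_of_pos (by positivity), Real.log_div (by positivity) (by positivity),
    Real.log_mul (by positivity) g1.ne', Real.log_mul g2.ne' g3.ne', one_div h, Real.log_inv,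
    Real.log_mul hh.ne' hq0.ne', Real.log_mul hh.ne' hq1.ne']
  congr 1
  field_simp
  ring

/-- The identity that turns `blissConst` into the closed form of the sharp constant; `x` and `y` stand
for `1 / p` and `1 / q`, `B` for the Beta value. -/
theorem blissConst_identity {S c m b B x y : ℝ} (hS : 0 < S) (hc : 0 < c) (hm : 0 < m) (hb : 0 < b)
    (hB : 0 < B) :
    (S / c) ^ (y + (1 - x)) * B ^ y * (b / m * B) ^ (-x) / m =
      S ^ (1 + y - x) * (1 / (c * m)) ^ ((1 - x) + y) * (m / b) ^ y * (1 / (b * B)) ^ (x - y) := by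
  obtain ⟨S, rfl⟩ : ∃ a, S = Real.exp a := ⟨_, (Real.exp_log hS).symm⟩
  obtain ⟨c, rfl⟩ : ∃ a, c = Real.exp a := ⟨_, (Real.exp_log hc).symm⟩
  obtain ⟨m, rfl⟩ : ∃ a, m = Real.exp a := ⟨_, (Real.exp_log hm).symm⟩
  obtain ⟨b, rfl⟩ : ∃ a, b = Real.exp a := ⟨_, (Real.exp_log hb).symm⟩
  obtain ⟨B, rfl⟩ : ∃ a, B = Real.exp a := ⟨_, (Real.exp_log hB).symm⟩
  simp only [one_div, ← Real.exp_neg, ← Real.exp_mul, ← Real.exp_add, ← Real.exp_sub]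
  congr 1
  ring

namespace HomogeneousGroup.QuasiNorm
variable {N : ℕ} {G : HomogeneousGroup N}

theorem sphereArea_pos (hN : 0 < N) (ν : G.QuasiNorm) : 0 < ν.sphereArea := by
  rw [ν.sphereArea_eq hN]
  exact mul_pos (homDim_pos hN G) (ν.powerGrowth hN).const_pos

/-- The sharp constant is the constant of Bliss's inequality for the gauge `|x| ^ c`, along which
Lebesgue measure grows like the power `Q / c`. -/
theorem sharpConstant_eq_blissConst (hN : 0 < N) (ν : G.QuasiNorm) {p q α : ℝ} (hp : 1 < p)
    (hpq : p < q) (hα : G.homDim * (p - 1) < α) {m c : ℝ} (hm : m = p / (q - p))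
    (hc : c = (α - G.homDim * (p - 1)) / ((p - 1) * m)) :
    ν.sharpConstant p q α = blissConst (G.homDim / c * volume.real (ν.ball 1)) p m := by
  have hS := ν.sphereArea_pos hN
  have hd : 0 < q - p := by linarith
  have hp0 : 0 < p := by linarith
  have hp1 : 0 < p - 1 := by linarith
  have hq0 : 0 < q := by linarith
  have hm0 : 0 < m := by rw [hm]; positivity
  have hα0 : 0 < α - G.homDim * (p - 1) := by linarith
  have hc0 : 0 < c := by rw [hc]; positivity
  have hb : 0 < (p - 1) * (m + 1) := by positivity
  have hB := ProbabilityTheory.beta_pos hb (show 0 < m + 1 by linarith)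
  have eA : G.homDim / c * volume.real (ν.ball 1) = ν.sphereArea / c := by
    rw [ν.sphereArea_eq hN]; ring
  have eq1 : m / (p * (m + 1)) = 1 / q := by rw [hm]; field_simp; ring
  have eB2 : ProbabilityTheory.beta ((p - 1) * (m + 1) + 1) m =
      (p - 1) * (m + 1) / m * ProbabilityTheory.beta ((p - 1) * (m + 1)) (m + 1) := by
    have := beta_add_one_left hb hm0
    field_simp
    linarith
  have ep : (p - 1) / p = 1 - 1 / p := by field_simp
  have f1 : (p - 1) / (α - G.homDim * (p - 1)) = 1 / (c * m) := by rw [hc]; field_simp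
  have f2 : p.conjExponent / q = m / ((p - 1) * (m + 1)) := by
    rw [Real.conjExponent, hm]; field_simp; ring
  have f3 : 1 / p.conjExponent = 1 - 1 / p := by
    rw [Real.conjExponent]; field_simp
  have f4 : (q - p) / p * Real.Gamma (p * q / (q - p)) /
      (Real.Gamma (p / (q - p)) * Real.Gamma (p * (q - 1) / (q - p))) =
      1 / ((p - 1) * (m + 1) * ProbabilityTheory.beta ((p - 1) * (m + 1)) (m + 1)) := by
    have g1 : p * q / (q - p) = (p - 1) * (m + 1) + (m + 1) := by rw [hm]; field_simp; ring
    have g2 : p * (q - 1) / (q - p) = (p - 1) * (m + 1) + 1 := by rw [hm]; field_simp; ring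
    have g3 : (q - p) / p = 1 / m := by rw [hm]; field_simp
    rw [g1, g2, g3, ← hm, ProbabilityTheory.beta, Real.Gamma_add_one hb.ne',
      Real.Gamma_add_one hm0.ne']
    have x1 := Real.Gamma_pos_of_pos hm0
    have x2 := Real.Gamma_pos_of_pos hb
    have x3 := Real.Gamma_pos_of_pos (show 0 < (p - 1) * (m + 1) + (m + 1) by linarith)
    generalize Real.Gamma ((p - 1) * (m + 1)) = y at *
    field_simp
  unfold sharpConstant blissConst
  rw [eA, eq1, eB2, ep, f1, f2, f3, f4]
  exact (blissConst_identity hS hc0 hm0 hb hB).symm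

theorem tendsto_sharpConstant (hN : 0 < N) (ν : G.QuasiNorm) {q α : ℝ} (hq : 1 < q)
    (hα : G.homDim * (q - 1) < α) :
    Tendsto (fun s : ℝ => ν.sharpConstant s q α) (𝓝[<] q)
      (𝓝 (q * ν.sphereArea / (α - G.homDim * (q - 1)))) := by
  have hS := ν.sphereArea_pos hN
  have hq0 : 0 < q := by linarith
  have hq1 : 0 < q - 1 := by linarith
  have hα0 : 0 < α - G.homDim * (q - 1) := by linarith
  have hid : Tendsto (fun s : ℝ => s) (𝓝[<] q) (𝓝 q) := tendsto_id.mono_left nhdsWithin_le_nhds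
  have hinv : Tendsto (fun s : ℝ => 1 / s) (𝓝[<] q) (𝓝 (1 / q)) :=
    tendsto_const_nhds.div hid hq0.ne'
  have hconj : Tendsto (fun s : ℝ => s.conjExponent) (𝓝[<] q) (𝓝 (q / (q - 1))) :=
    hid.div (hid.sub_const 1) hq1.ne'
  have t1 : Tendsto (fun s : ℝ => ν.sphereArea ^ (1 + 1 / q - 1 / s)) (𝓝[<] q)
      (𝓝 ν.sphereArea) := by
    have := (tendsto_const_nhds (x := ν.sphereArea)).rpow (hinv.const_sub (1 + 1 / q))
      (Or.inl hS.ne')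
    simpa using this
  have t2 : Tendsto (fun s : ℝ =>
      ((s - 1) / (α - G.homDim * (s - 1))) ^ (1 / s.conjExponent + 1 / q)) (𝓝[<] q)
      (𝓝 ((q - 1) / (α - G.homDim * (q - 1)))) := by
    have h1 : Tendsto (fun s : ℝ => (s - 1) / (α - G.homDim * (s - 1))) (𝓝[<] q)
        (𝓝 ((q - 1) / (α - G.homDim * (q - 1)))) :=
      (hid.sub_const 1).div (((hid.sub_const 1).const_mul _).const_sub _) hα0.ne'
    have h2 : Tendsto (fun s : ℝ => 1 / s.conjExponent + 1 / q) (𝓝[<] q)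
        (𝓝 (1 / (q / (q - 1)) + 1 / q)) :=
      (tendsto_const_nhds.div hconj (by positivity)).add_const _
    have h3 := h1.rpow h2 (Or.inl (by positivity))
    have e : 1 / (q / (q - 1)) + 1 / q = 1 := by field_simp; ring
    rwa [e, Real.rpow_one] at h3
  have t3 : Tendsto (fun s : ℝ => (s.conjExponent / q) ^ (1 / q)) (𝓝[<] q)
      (𝓝 ((1 / (q - 1)) ^ (1 / q))) := by
    have h1 := (hconj.div_const q).rpow_const (p := 1 / q) (Or.inl (by positivity))
    have e : q / (q - 1) / q = 1 / (q - 1) := by field_simp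
    rwa [e] at h1
  have t4 : Tendsto (fun s : ℝ => (((q - s) / s * Real.Gamma (s * q / (q - s))) /
      (Real.Gamma (s / (q - s)) * Real.Gamma (s * (q - 1) / (q - s)))) ^ (1 / s - 1 / q)) (𝓝[<] q)
      (𝓝 (q * (q - 1) ^ (-((q - 1) / q)))) := by
    have hh : Tendsto (fun s : ℝ => s / (q - s)) (𝓝[<] q) atTop := by
      have h0 : Tendsto (fun s : ℝ => q - s) (𝓝[<] q) (𝓝[>] 0) := by
        rw [tendsto_nhdsWithin_iff]
        refine ⟨by simpa using hid.const_sub q, ?_⟩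
        filter_upwards [self_mem_nhdsWithin] with s hs
        have : s < q := hs
        simpa using this
      exact hid.pos_mul_atTop hq0 (tendsto_inv_nhdsGT_zero.comp h0)
    refine ((tendsto_Gamma_factor hq).comp hh).congr' ?_
    have hpos : ∀ᶠ s : ℝ in 𝓝[<] q, 0 < s := hid.eventually_const_lt hq0
    filter_upwards [self_mem_nhdsWithin, hpos] with s hs hs0
    have hs' : 0 < q - s := by have : s < q := hs; linarith
    simp only [Function.comp_apply]
    congr 1
    · congr 2
      · field_simp
      · congr 1; ring
      · congr 1; ring
    · field_simp
  have h := ((t1.mul t2).mul t3).mul t4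
  have e : ν.sphereArea * ((q - 1) / (α - G.homDim * (q - 1))) * (1 / (q - 1)) ^ (1 / q) *
      (q * (q - 1) ^ (-((q - 1) / q))) = q * ν.sphereArea / (α - G.homDim * (q - 1)) := by
    have h1 : (1 / (q - 1)) ^ (1 / q) * (q - 1) ^ (-((q - 1) / q)) = (q - 1)⁻¹ := by
      rw [one_div (q - 1), Real.inv_rpow hq1.le, ← Real.rpow_neg hq1.le, ← Real.rpow_add hq1,
        ← Real.rpow_neg_one]
      congr 1; field_simp; ring
    calc _ = ν.sphereArea * ((q - 1) / (α - G.homDim * (q - 1))) * q *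
          ((1 / (q - 1)) ^ (1 / q) * (q - 1) ^ (-((q - 1) / q))) := by ring
      _ = _ := by rw [h1]; field_simp
  rw [e] at h
  exact h

end HomogeneousGroup.QuasiNorm

/-! ### Reduction to the normalised exponents -/

section
variable {X : Type*} [MeasurableSpace X] {μ : Measure X} {ρ : X → ℝ} {V Q : ℝ} {u : X → ℝ≥0∞}

/-- Under the necessary conditions on the exponents, the power `ρ ^ c` of the gauge brings the
inequality to the normalised form of `PowerGrowth.bliss`. -/
theorem PowerGrowth.tailInequality_iff_rpow (h : PowerGrowth μ ρ V Q) {p q α β : ℝ}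
    (hp : 1 < p) (hpq : p < q) (hα : Q * (p - 1) < α)
    (hrel : q * (α + Q) - p * (β + Q) = p * q * Q) {m c : ℝ} (hm : m = p / (q - p))
    (hc : c = (α - Q * (p - 1)) / ((p - 1) * m)) (K : ℝ≥0∞) :
    TailInequality μ ρ p q α β K ↔
      TailInequality μ (fun x => ρ x ^ c) p (p * (m + 1) / m) ((p - 1) * (m + Q / c))
        ((p - 1) * (m + 1) - Q / c) K := by
  have hd : 0 < q - p := by linarith
  have hp0 : 0 < p := by linarith
  have hp1 : 0 < p - 1 := by linarith
  have hm0 : 0 < m := by rw [hm]; positivity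
  have hα0 : 0 < α - Q * (p - 1) := by linarith
  have hc0 : 0 < c := by rw [hc]; positivity
  have e1 : p * (m + 1) / m = q := by rw [hm]; field_simp; ring
  have e0 : c * ((p - 1) * m) = α - Q * (p - 1) := by rw [hc]; field_simp
  have e2 : (p - 1) * (m + Q / c) = α / c := by
    field_simp; linarith
  have e3 : (p - 1) * (m + 1) - Q / c = β / c := by
    field_simp
    have e1' : p * (m + 1) = q * m := by rw [← e1]; field_simp
    have : p * (c * (p - 1) * (m + 1) - Q) = p * β := by
      linear_combination q * e0 + hrel + c * (p - 1) * e1'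
    have := mul_left_cancel₀ hp0.ne' this
    linarith
  rw [e1, e2, e3, tailInequality_rpow h.nonneg hc0]

end

end

theorem theorem3p2 {N : ℕ} (hN : 0 < N) (G : HomogeneousGroup N) (ν : G.QuasiNorm)
    (𝕜 : Type*) [RCLike 𝕜] (p q α β : ℝ) (hp : 1 < p) (hpq : p ≤ q) :
    ((∃ C : ℝ, 0 ≤ C ∧ ν.ConjugateHardyInequality 𝕜 p q α β C) ↔
      (G.homDim * (p - 1) < α ∧
        q * (α + G.homDim) - p * (β + G.homDim) = p * q * G.homDim)) ∧
    (G.homDim * (p - 1) < α →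
      q * (α + G.homDim) - p * (β + G.homDim) = p * q * G.homDim →
      (p < q →
        IsLeast {C : ℝ | 0 ≤ C ∧ ν.ConjugateHardyInequality 𝕜 p q α β C}
          (ν.sharpConstant p q α)) ∧
      (p = q →
        IsLeast {C : ℝ | 0 ≤ C ∧ ν.ConjugateHardyInequality 𝕜 p q α β C}
          (p * ν.sphereArea / (α - G.homDim * (p - 1))) ∧
        Tendsto (fun s : ℝ => ν.sharpConstant s q α) (𝓝[<] q)
          (𝓝 (p * ν.sphereArea / (α - G.homDim * (p - 1)))))) := by
  have hp0 : 0 < p := by linarith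
  have hq0 : 0 < q := by linarith
  have hg := ν.powerGrowth hN
  have hQ := HomogeneousGroup.homDim_pos hN G
  have hV := hg.const_pos
  simp only [ν.conjugateHardyInequality_iff hN 𝕜 hp0 hq0]
  have hlt : G.homDim * (p - 1) < α →
      q * (α + G.homDim) - p * (β + G.homDim) = p * q * G.homDim → p < q →
        IsLeast {C : ℝ | 0 ≤ C ∧ TailInequality volume ν.toFun p q α β (ENNReal.ofReal C)}
          (ν.sharpConstant p q α) := by
    intro hα hrel hpq'
    set m := p / (q - p) with hm
    set c := (α - G.homDim * (p - 1)) / ((p - 1) * m) with hc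
    have hd : 0 < q - p := by linarith
    have hp1 : 0 < p - 1 := by linarith
    have hm0 : 0 < m := by positivity
    have hα0 : 0 < α - G.homDim * (p - 1) := by linarith
    have hc0 : 0 < c := by positivity
    have hg' := hg.rpow hc0
    simp only [hg.tailInequality_iff_rpow hp hpq' hα hrel hm hc]
    rw [ν.sharpConstant_eq_blissConst hN hp hpq' hα hm hc]
    refine ⟨⟨(blissConst_pos (by positivity) hp hm0).le, hg'.bliss hp hm0⟩, fun C hC => ?_⟩
    exact (ENNReal.ofReal_le_ofReal_iff hC.1).1 (hg'.blissConst_le hp hm0 hC.2)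
  have heq : G.homDim * (p - 1) < α →
      q * (α + G.homDim) - p * (β + G.homDim) = p * q * G.homDim → p = q →
        IsLeast {C : ℝ | 0 ≤ C ∧ TailInequality volume ν.toFun p q α β (ENNReal.ofReal C)}
          (p * ν.sphereArea / (α - G.homDim * (p - 1))) := by
    rintro hα hrel rfl
    have hα0 : 0 < α - G.homDim * (p - 1) := by linarith
    have hβ : β = α - p * G.homDim := by
      have : p * β = p * (α - p * G.homDim) := by linarith
      exact mul_left_cancel₀ hp0.ne' this
    rw [hβ, ν.sphereArea_eq hN]
    exact ⟨⟨by positivity, hg.hardy hp hα⟩, fun C hC =>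
      (ENNReal.ofReal_le_ofReal_iff hC.1).1 (hg.hardyConst_le hp hα hC.2)⟩
  refine ⟨⟨?_, ?_⟩, fun hα hrel => ⟨hlt hα hrel, fun h => ⟨heq hα hrel h, ?_⟩⟩⟩
  · rintro ⟨C, _, hC⟩
    exact ⟨hg.lt_of_tailInequality hp hq0 ENNReal.ofReal_ne_top hC,
      hg.homogeneity_of_tailInequality hp hq0 ENNReal.ofReal_ne_top hC⟩
  · rintro ⟨hα, hrel⟩
    rcases hpq.lt_or_eq with h | h
    · exact ⟨_, (hlt hα hrel h).1⟩
    · exact ⟨_, (heq hα hrel h).1⟩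
  · subst h
    exact ν.tendsto_sharpConstant hN hp hα
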